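/- **Setting.** Let $T>0$, and let $p:[0,T]\times\mathbb{R}^d\to\mathbb{R}$ be the space-time density of a flow of probability measures $\mu_t(dx)=p(t,x)\,dx$, $0\le t\le T$. Let - $\mathcal{U}$ be the set of $u\in L^1([0,T]\times\mathbb{R}^d;\mathbb{R}^d,\,p\,dt\,dx)$ such that $\mathrm{div}_x(pu)\in L^1((0,T)\times\mathbb{R}^d)$ in the weak sense (test functions $C_c^\infty((0,T)\times\mathbb{R}^d)$); - $\mathcal{U}_0$ be the set of $u\in\mathcal{U}$ such that for all $\varphi\in C^1_b([0,T]\times\mathbb{R}^d)$ and $t\in[0,T]$, $$\int\varphi(t,x)p(t,x)\,dx-\int\varphi(0,x)p(0,x)\,dx=\int_0^t\!\!\int\bigl(\partial_s\varphi+u^{\mathsf T}\nabla_x\varphi\bigr)\,p\,dx\,ds ;$$ - $V_0(\mu)=\inf_{u\in\mathcal{U}_0}\int_0^T\!\int|u|^2p\,dx\,dt\in[0,\infty]$. Let $K:\mathbb{R}^{d+1}\to\mathbb{R}$ be positive definite (that is, $K$ is even and all Gram matrices $(K(\xi_i-\xi_j))_{i,j}$ are positive semidefinite), let $\mathcal{H}$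 be the reproducing kernel Hilbert space on $\mathbb{R}^{d+1}$ of the kernel $(\xi,\eta)\mapsto K(\xi-\eta)$, with norm $\|\cdot\|$, and for $u\in\mathcal{U}$ and $s\in[0,T]$ put $$H^u_s(\xi)=\int_0^s\!\!\int p(r,y)\bigl(\partial_r+u(r,y)^{\mathsf T}\nabla_y\bigr)K(\xi-(r,y))\,dy\,dr-\int p(s,y)K(\xi-(s,y))\,dy+\int p(0,y)K(\xi-(0,y))\,dy .$$ For $\lambda>0$ let $$J_\lambda(u)=\int_0^T\!\!\int|u|^2p\,dx\,dt+\lambda\int_0^T\|H^u_t\|^2\,dt\in[0,\infty],\qquad V_\lambda(\mu)=\inf_{u\in\mathcal{U}}J_\lambda(u).$$ **Assumptions.** - (A1) $K\in C(\mathbb{R}^{d+1})\cap L^1(\mathbb{R}^{d+1})$ is positive definite and its Fourier transform satisfies $\mathrm{supp}\,\widehat K=\mathbb{R}^{d+1}$. - (A2) $\int_{\mathbb{R}^{d+1}}(1+|z|^2)\,\widehat K(z)\,dz<\infty$. - (A3) $p\in C([0,T];L^1(\mathbb{R}^d))\cap L^\infty([0,T]\times\mathbb{R}^d)$, each $p(t,\cdot)$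 is a probability density, and $\partial_tp\in L^1((0,T)\times\mathbb{R}^d)$ in the weak sense. - (A4) The infimum defining $V_0(\mu)$ is attained by some $u^*\in\mathcal{U}_0$, unique up to $p\,dt\,dx$-null sets, and there is $\psi\in C_b^1([0,T]\times\mathbb{R}^d)$ with $u^*=\nabla_x\psi$ $p\,dt\,dx$-a.e. **Theorem.** Assume (A1)–(A3) and $V_0(\mu)<\infty$. Let $\varepsilon_n>0$, $\lambda_n>0$ with $\varepsilon_n\to0$ and $\lambda_n\to\infty$, and let $u_n\in\mathcal{U}$ satisfy $J_{\lambda_n}(u_n)\le V_{\lambda_n}(\mu)+\varepsilon_n$ for all $n$. Then $$\lim_{n\to\infty}\lambda_n\int_0^T\|H_t^{u_n}\|^2\,dt=0,\qquad \lim_{n\to\infty}J_{\lambda_n}(u_n)=V_0(\mu),\qquad \sup_{\lambda>0}\inf_{u\in\mathcal{U}}J_\lambda(u)=V_0(\mu).$$ If moreover (A4) holds, then $u_n$ and $u^*$ belong to $L^2([0,T]\times\mathbb{R}^d;\mathbb{R}^d,\,p\,dt\,dx)$ and $u_n\to u^*$ in this space. -/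

import Mathlib

open MeasureTheory Filter Topology Set
open scoped ENNReal ContDiff FourierTransform InnerProductSpace

noncomputable section

namespace AllTimeOT

/-- The state space `ℝ^d` with its Euclidean norm. -/
abbrev Space (d : ℕ) : Type := EuclideanSpace ℝ (Fin d)

/-- Space-time `ℝ^{d+1}`, with points `(t, x)`. -/
abbrev SpaceTime (d : ℕ) : Type := ℝ × Space d

variable {d : ℕ}

/-- The closed slab `[0, T] × ℝ^d`. -/
def slab (d : ℕ) (T : ℝ) : Set (SpaceTime d) := Icc 0 T ×ˢ univ

/-- The open slab `(0, T) × ℝ^d`. -/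
def openSlab (d : ℕ) (T : ℝ) : Set (SpaceTime d) := Ioo 0 T ×ˢ univ

/-- The partial derivative `∂_t φ (t, x)`. -/
def timeDeriv (φ : SpaceTime d → ℝ) (z : SpaceTime d) : ℝ :=
  deriv (fun s : ℝ => φ (s, z.2)) z.1

/-- The spatial gradient `∇_x φ (t, x)`. -/
def spaceGrad (φ : SpaceTime d → ℝ) (z : SpaceTime d) : Space d :=
  gradient (fun y : Space d => φ (z.1, y)) z.2

/-- The operator `𝒜^u φ = ∂_t φ + uᵀ ∇_x φ`. -/
def transportOp (u : SpaceTime d → Space d) (φ : SpaceTime d → ℝ) (z : SpaceTime d) : ℝ :=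
  timeDeriv φ z + ⟪u z, spaceGrad φ z⟫_ℝ

/-- Test functions of class `C_c^∞((0, T) × ℝ^d)`, used for weak derivatives. -/
structure IsTestFunction (T : ℝ) (φ : SpaceTime d → ℝ) : Prop where
  smooth : ContDiff ℝ ∞ φ
  compact : HasCompactSupport φ
  support : tsupport φ ⊆ openSlab d T

/-- The class `C_b^1([0, T] × ℝ^d)`: functions that are continuously differentiable on the closed
slab (one-sided at `t = 0` and `t = T`), bounded there together with their derivative. -/
structure IsCb1 (T : ℝ) (φ : SpaceTime d → ℝ) : Prop where
  contDiffOn : ContDiffOn ℝ 1 φ (slab d T)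
  bounded : ∃ C : ℝ, ∀ z ∈ slab d T, |φ z| ≤ C ∧ ‖fderivWithin ℝ φ (slab d T) z‖ ≤ C

/-! ### Reproducing kernel Hilbert space of a translation-invariant kernel -/

/-- `K` is a (real, symmetric) positive definite function on `ℝ^{d+1}`: the kernel `K (ξ - η)` is
symmetric and all its Gram matrices have nonnegative quadratic form. -/
def IsPositiveDefinite (K : SpaceTime d → ℝ) : Prop :=
  (∀ ξ, K (-ξ) = K ξ) ∧
    ∀ (s : Finset (SpaceTime d)) (c : SpaceTime d → ℝ),
      0 ≤ ∑ ξ ∈ s, ∑ η ∈ s, c ξ * c η * K (ξ - η)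

/-- The kernel `(ξ, η) ↦ K (ξ - η)`, its values being viewed as multiplication operators on `ℝ`. -/
def kernelMatrix (K : SpaceTime d → ℝ) : Matrix (SpaceTime d) (SpaceTime d) (ℝ →L[ℝ] ℝ) :=
  Matrix.of fun ξ η => K (ξ - η) • ContinuousLinearMap.id ℝ ℝ

/-- The kernel of a positive definite function satisfies the condition under which Mathlib
constructs the reproducing kernel Hilbert space. -/
theorem kernelMatrix_posSemidef {K : SpaceTime d → ℝ} (hK : IsPositiveDefinite K) :
    (kernelMatrix K).PosSemidef := by
  have key := ((RKHS.posSemidef_tfae (K := kernelMatrix K)).out 0 2).mpr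
  refine key ⟨?_, fun vv => ?_⟩
  · ext ξ η
    have h := hK.1 (ξ - η)
    rw [neg_sub] at h
    have h1 : star (ContinuousLinearMap.id ℝ ℝ) = ContinuousLinearMap.id ℝ ℝ :=
      star_one (ℝ →L[ℝ] ℝ)
    simp [kernelMatrix, Matrix.conjTranspose_apply, h, star_smul, h1]
  · have h := hK.2 vv.support vv
    simp only [Finsupp.sum, kernelMatrix, Matrix.of_apply]
    refine le_of_le_of_eq h ?_
    simp only [RCLike.re_to_real]
    refine Finset.sum_congr rfl fun ξ _ => Finset.sum_congr rfl fun η _ => ?_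
    have h' := hK.1 (ξ - η)
    rw [neg_sub] at h'
    simp [h']
    ring

/-- The norm of `f : ℝ^{d+1} → ℝ` in the reproducing kernel Hilbert space `ℋ` of the kernel
`K (ξ - η)`, with the value `∞` if `f` is not in `ℋ`. (An element `h` of `ℋ` with `⇑h = f` is
unique if it exists. The binder over the proof of positive definiteness is only there to make
`ℋ` available.) -/
def rkhsENorm (K : SpaceTime d → ℝ) (f : SpaceTime d → ℝ) : ℝ≥0∞ :=
  ⨅ (_ : Fact (kernelMatrix K).PosSemidef) (h : RKHS.OfKernel (kernelMatrix K))
    (_ : ⇑h = f), ‖h‖ₑ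

/-- The Fourier transform of `K` on Euclidean `ℝ^{d+1}`, in the normalization
`∫ exp (-2 π i ⟨z, ξ⟩) K ξ dξ`. The conditions imposed on it below do not depend on the
normalization. -/
def kernelFourier (K : SpaceTime d → ℝ) : WithLp 2 (SpaceTime d) → ℂ :=
  𝓕 (fun ξ : WithLp 2 (SpaceTime d) => (K (WithLp.ofLp ξ) : ℂ))

/-- The condition on the kernel: `K` is continuous, integrable and positive definite, and
`supp K̂ = ℝ^{d+1}`. -/
structure KernelAdmissible (K : SpaceTime d → ℝ) : Prop where
  continuous : Continuous K
  integrable : Integrable K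
  posDef : IsPositiveDefinite K
  full_support : tsupport (kernelFourier K) = univ

/-- The moment condition `∫ (1 + |z|²) K̂(z) dz < ∞` (recall `K̂ ≥ 0` for positive definite `K`). -/
def KernelMoment (K : SpaceTime d → ℝ) : Prop :=
  Integrable fun z : WithLp 2 (SpaceTime d) => (1 + ‖z‖ ^ 2) * ‖kernelFourier K z‖

/-! ### The marginal flow and the velocity fields -/

/-- The measure `p(t, x) dt dx` on `[0, T] × ℝ^d`. -/
def flowMeasure (T : ℝ) (p : SpaceTime d → ℝ) : Measure (SpaceTime d) :=
  (volume.restrict (slab d T)).withDensity fun z => ENNReal.ofReal (p z)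

/-- The condition on the marginal flow: `p ∈ C([0,T]; L¹(ℝ^d)) ∩ L^∞([0,T] × ℝ^d)`, every
`p(t, ·)` is a probability density, and `∂_t p ∈ L¹((0,T) × ℝ^d)` in the weak sense. -/
structure FlowAdmissible (T : ℝ) (p : SpaceTime d → ℝ) : Prop where
  memLp_top : MemLp p ⊤ (volume.restrict (slab d T))
  integrable : ∀ t ∈ Icc 0 T, Integrable fun x : Space d => p (t, x)
  nonneg : ∀ t ∈ Icc 0 T, ∀ᵐ x : Space d, 0 ≤ p (t, x)
  integral_eq_one : ∀ t ∈ Icc 0 T, ∫ x : Space d, p (t, x) = 1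
  continuous_L1 : ∀ s ∈ Icc 0 T,
    Tendsto (fun t => ∫ x : Space d, |p (t, x) - p (s, x)|) (𝓝[Icc 0 T] s) (𝓝 0)
  weak_timeDeriv : ∃ q : SpaceTime d → ℝ, IntegrableOn q (openSlab d T) ∧
    ∀ φ : SpaceTime d → ℝ, IsTestFunction T φ →
      ∫ z in openSlab d T, p z * timeDeriv φ z = -∫ z in openSlab d T, q z * φ z

/-- The class `𝒰` of velocity fields: `u ∈ L¹(p dt dx)` with `div_x (p u) ∈ L¹((0,T) × ℝ^d)` in
the weak sense. -/
structure IsVelocity (T : ℝ) (p : SpaceTime d → ℝ) (u : SpaceTime d → Space d) : Prop where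
  integrable : Integrable u (flowMeasure T p)
  weak_div : ∃ g : SpaceTime d → ℝ, IntegrableOn g (openSlab d T) ∧
    ∀ φ : SpaceTime d → ℝ, IsTestFunction T φ →
      ∫ z, ⟪u z, spaceGrad φ z⟫_ℝ ∂(flowMeasure T p) = -∫ z in openSlab d T, g z * φ z

/-- The class `𝒰₀` of admissible velocity fields: `u ∈ 𝒰` solving the continuity equation
`∂_t p + div (u p) = 0` weakly, against all test functions in `C_b^1([0,T] × ℝ^d)`. -/
structure IsAdmissible (T : ℝ) (p : SpaceTime d → ℝ) (u : SpaceTime d → Space d) : Prop where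
  isVelocity : IsVelocity T p u
  continuity_eq : ∀ φ : SpaceTime d → ℝ, IsCb1 T φ → ∀ t ∈ Icc 0 T,
    (∫ x : Space d, φ (t, x) * p (t, x)) - ∫ x : Space d, φ (0, x) * p (0, x) =
      ∫ z, transportOp u φ z ∂(flowMeasure t p)

/-- The kinetic energy `∫_0^T ∫ |u(t, x)|² p(t, x) dx dt ∈ [0, ∞]`. -/
def kineticEnergy (T : ℝ) (p : SpaceTime d → ℝ) (u : SpaceTime d → Space d) : ℝ≥0∞ :=
  ∫⁻ z, ‖u z‖ₑ ^ 2 ∂(flowMeasure T p)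

/-- The value `V_0(μ)` of the all-time optimal transport problem, an infimum in `[0, ∞]`. -/
def value0 (T : ℝ) (p : SpaceTime d → ℝ) : ℝ≥0∞ :=
  ⨅ (u : SpaceTime d → Space d) (_ : IsAdmissible T p u), kineticEnergy T p u

/-- The kernel residual
`H_s^u(ξ) = ∫_0^s ∫ p(r,y) 𝒜^u_{r,y} K(ξ - (r,y)) dy dr - ∫ p(s,y) K(ξ - (s,y)) dy
  + ∫ p(0,y) K(ξ - (0,y)) dy`. -/
def residual (K : SpaceTime d → ℝ) (p : SpaceTime d → ℝ) (u : SpaceTime d → Space d)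
    (s : ℝ) (ξ : SpaceTime d) : ℝ :=
  (∫ η, transportOp u (fun η' => K (ξ - η')) η ∂(flowMeasure s p))
    - (∫ y : Space d, p (s, y) * K (ξ - (s, y)))
    + ∫ y : Space d, p (0, y) * K (ξ - (0, y))

/-- The penalty `∫_0^T ‖H_t^u‖² dt ∈ [0, ∞]`, in the norm of the reproducing kernel Hilbert
space of `K`. -/
def penalty (K : SpaceTime d → ℝ) (T : ℝ) (p : SpaceTime d → ℝ)
    (u : SpaceTime d → Space d) : ℝ≥0∞ :=
  ∫⁻ t in Icc 0 T, rkhsENorm K (residual K p u t) ^ 2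

/-- The penalized objective `J_λ(u)`. -/
def objective (K : SpaceTime d → ℝ) (T : ℝ) (p : SpaceTime d → ℝ) (lam : ℝ)
    (u : SpaceTime d → Space d) : ℝ≥0∞ :=
  kineticEnergy T p u + ENNReal.ofReal lam * penalty K T p u

/-- The value `V_λ(μ) = inf_{u ∈ 𝒰} J_λ(u)` of the penalized problem. -/
def penalizedValue (K : SpaceTime d → ℝ) (T : ℝ) (p : SpaceTime d → ℝ) (lam : ℝ) : ℝ≥0∞ :=
  ⨅ (u : SpaceTime d → Space d) (_ : IsVelocity T p u), objective K T p lam u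

/-- `u` is the unique (up to `p dt dx`-null sets) minimizer of the all-time optimal transport
problem, and it is the spatial gradient of a potential `ψ ∈ C_b^1([0,T] × ℝ^d)`. -/
structure IsUniqueGradientMinimizer (T : ℝ) (p : SpaceTime d → ℝ)
    (u : SpaceTime d → Space d) : Prop where
  isAdmissible : IsAdmissible T p u
  isMinimizer : kineticEnergy T p u = value0 T p
  unique : ∀ v : SpaceTime d → Space d, IsAdmissible T p v →
    kineticEnergy T p v = value0 T p → v =ᵐ[flowMeasure T p] u
  gradient : ∃ ψ : SpaceTime d → ℝ, IsCb1 T ψ ∧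
    ∀ᵐ z ∂(flowMeasure T p), u z = spaceGrad ψ z

end AllTimeOT

end

/-!
An almost minimizer `u_n` of the penalized problem has penalized objective at most `V₀(μ) + ε_n`,
because the fields in `𝒰₀` have zero residual: translates of the kernel `K` are admissible test
functions (`IsAdmissible.residual_eq_zero`), the moment condition on `K̂` making `K` continuously
differentiable with bounds. Hence the fields `u_n` are bounded in `L²(p dt dx)`, and their penalties
tend to zero. A subsequence converges weakly in `L²` to some `w`. At a fixed point `ξ` the residual
`H_t^u(ξ)` is affine and weakly continuous in `u` (`residual_sub_residual_eq_inner`) and is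
controlled by the norm of the reproducing kernel Hilbert space, so Fatou's lemma in `t` and
continuity in `t` show that the residual of `w` vanishes for every `t`
(`residual_eq_zero_of_tendsto`).

The core of the argument is that a field with zero residual satisfies the continuity equation
against every test function in `C_b^1` (`isAdmissible_of_residual_eq_zero`). The defect in the
continuity equation is a linear functional of the test function `φ`
(`continuityDefect`), given by finite measures applied to `φ` and to its first derivatives. Its
Fourier transform `Λ` is a continuous function, and the residual is the inverse Fourier transform
of `Λ · K̂`. As `K̂` is nonzero on a dense set, `Λ` vanishes
(`continuityDefect_planeWave_eq_zero`), which by Fourier inversion gives the equation for smooth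
compactly supported `φ`. Mollification, a contraction in time and a cutoff in space extend it to
`C_b^1` (`continuityDefect_eq_zero_of_isCb1`); the contraction takes care of the fact that such
functions are only defined on the closed slab.

Therefore `w` competes in the problem defining `V₀(μ)`, so that
`V₀(μ) ≤ ‖w‖² ≤ liminf ‖u_n‖² ≤ V₀(μ)` along the subsequence. Weak convergence together with
convergence of norms is strong convergence (`exists_subseq_tendsto_minimizer`), and all claims
follow by passing to subsequences. When the minimizer is unique, the limit does not depend on the
subsequence; the gradient structure of the minimizer plays no role.
-/

noncomputable section

namespace AllTimeOT

variable {d : ℕ}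

/-! ### The measure `p dt dx` -/

theorem measurableSet_slab (t : ℝ) : MeasurableSet (slab d t) :=
  measurableSet_Icc.prod MeasurableSet.univ

theorem measurableSet_openSlab (t : ℝ) : MeasurableSet (openSlab d t) :=
  measurableSet_Ioo.prod MeasurableSet.univ

theorem isOpen_openSlab (t : ℝ) : IsOpen (openSlab d t) := isOpen_Ioo.prod isOpen_univ

theorem openSlab_subset_slab (t : ℝ) : openSlab d t ⊆ slab d t :=
  prod_mono Ioo_subset_Icc_self subset_rfl

theorem slab_mono {t T : ℝ} (h : t ≤ T) : slab d t ⊆ slab d T :=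
  prod_mono (Icc_subset_Icc_right h) subset_rfl

theorem restrict_slab_eq_prod (T : ℝ) :
    (volume : Measure (SpaceTime d)).restrict (slab d T) =
      (volume.restrict (Icc 0 T)).prod volume := by
  rw [slab, Measure.volume_eq_prod, ← Measure.prod_restrict, Measure.restrict_univ]

theorem restrict_openSlab_eq_restrict_slab (T : ℝ) :
    (volume : Measure (SpaceTime d)).restrict (openSlab d T) = volume.restrict (slab d T) := by
  rw [slab, openSlab, Measure.volume_eq_prod, ← Measure.prod_restrict, ← Measure.prod_restrict,
    restrict_Ioo_eq_restrict_Icc]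

theorem flowMeasure_eq_restrict {t T : ℝ} (h : t ≤ T) (p : SpaceTime d → ℝ) :
    flowMeasure t p = (flowMeasure T p).restrict (slab d t) := by
  rw [flowMeasure, flowMeasure, restrict_withDensity (measurableSet_slab t),
    Measure.restrict_restrict (measurableSet_slab t), inter_eq_left.2 (slab_mono h)]

theorem ae_flowMeasure_mem_openSlab (T : ℝ) (p : SpaceTime d → ℝ) :
    ∀ᵐ z ∂(flowMeasure T p), z ∈ openSlab d T := by
  refine (withDensity_absolutelyContinuous _ _).ae_le ?_
  rw [← restrict_openSlab_eq_restrict_slab]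
  exact ae_restrict_mem (measurableSet_openSlab T)

namespace FlowAdmissible

variable {T : ℝ} {p : SpaceTime d → ℝ}

theorem aestronglyMeasurable (hp : FlowAdmissible T p) :
    AEStronglyMeasurable p (volume.restrict (slab d T)) := hp.memLp_top.1

theorem ae_nonneg (hp : FlowAdmissible T p) :
    ∀ᵐ z ∂(volume.restrict (slab d T)), 0 ≤ p z := by
  have hm := hp.aestronglyMeasurable
  rw [restrict_slab_eq_prod] at hm ⊢
  -- A measurable version of `p` is needed, as the quantifiers `∀ᵐ z` and `∀ t, ∀ᵐ x` can be
  -- exchanged for measurable predicates only.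
  have h1 := hm.ae_eq_mk
  have h2 := Measure.ae_ae_of_ae_prod h1
  have h3 : ∀ᵐ z ∂((volume.restrict (Icc 0 T)).prod (volume : Measure (Space d))),
      0 ≤ hm.mk p z := by
    rw [Measure.ae_prod_iff_ae_ae
      (measurableSet_le measurable_const hm.stronglyMeasurable_mk.measurable)]
    filter_upwards [h2, ae_restrict_mem measurableSet_Icc] with t ht hmem
    filter_upwards [ht, hp.nonneg t hmem] with x hx hx0
    rwa [← hx]
  filter_upwards [h1, h3] with z hz hz0
  rwa [hz]

theorem isFiniteMeasure_flowMeasure (hp : FlowAdmissible T p) :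
    IsFiniteMeasure (flowMeasure T p) := by
  refine ⟨?_⟩
  have hm : AEMeasurable (fun z => ENNReal.ofReal (p z))
      ((volume.restrict (Icc 0 T)).prod (volume : Measure (Space d))) := by
    rw [← restrict_slab_eq_prod]
    exact hp.aestronglyMeasurable.aemeasurable.ennreal_ofReal
  rw [flowMeasure, withDensity_apply _ MeasurableSet.univ, Measure.restrict_univ,
    restrict_slab_eq_prod, lintegral_prod _ hm]
  have h1 : ∀ t ∈ Icc 0 T, ∫⁻ x : Space d, ENNReal.ofReal (p (t, x)) = 1 := by
    intro t ht
    rw [← ofReal_integral_eq_lintegral_ofReal (hp.integrable t ht) (hp.nonneg t ht),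
      hp.integral_eq_one t ht, ENNReal.ofReal_one]
  rw [setLIntegral_congr_fun measurableSet_Icc h1]
  simp

/-- Integration against `p dt dx` agrees with integration of the product with `p`, as `p ≥ 0`. -/
theorem integral_flowMeasure (hp : FlowAdmissible T p) (f : SpaceTime d → ℝ) :
    ∫ z, f z ∂(flowMeasure T p) = ∫ z in openSlab d T, p z * f z := by
  rw [flowMeasure, integral_withDensity_eq_integral_toReal_smul₀
    hp.aestronglyMeasurable.aemeasurable.ennreal_ofReal (by simp),
    restrict_openSlab_eq_restrict_slab]
  refine integral_congr_ae ?_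
  filter_upwards [hp.ae_nonneg] with z hz
  simp [ENNReal.toReal_ofReal hz]

theorem isFiniteMeasure_flowMeasure_of_le (hp : FlowAdmissible T p) {t : ℝ} (ht : t ≤ T) :
    IsFiniteMeasure (flowMeasure t p) := by
  have := hp.isFiniteMeasure_flowMeasure
  rw [flowMeasure_eq_restrict ht]
  infer_instance

end FlowAdmissible

theorem integrable_flowMeasure_of_le {F : Type*} [NormedAddCommGroup F] {t T : ℝ} (h : t ≤ T)
    {p : SpaceTime d → ℝ} {f : SpaceTime d → F} (hf : Integrable f (flowMeasure T p)) :
    Integrable f (flowMeasure t p) := by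
  rw [flowMeasure_eq_restrict h]
  exact hf.restrict

/-! ### The defect in the continuity equation -/

theorem transportOp_eq_fderiv {u : SpaceTime d → Space d} {φ : SpaceTime d → ℝ} {z : SpaceTime d}
    (h : DifferentiableAt ℝ φ z) : transportOp u φ z = fderiv ℝ φ z (1, u z) := by
  have h1 : timeDeriv φ z = fderiv ℝ φ z (1, 0) := by
    have hc : HasDerivAt (fun s : ℝ => ((s, z.2) : SpaceTime d)) (1, 0) z.1 :=
      (hasDerivAt_id z.1).prodMk (hasDerivAt_const _ _)
    exact (HasFDerivAt.comp_hasDerivAt z.1 (f := fun s : ℝ => ((s, z.2) : SpaceTime d))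
      h.hasFDerivAt hc).deriv
  have h2 : ⟪u z, spaceGrad φ z⟫_ℝ = fderiv ℝ φ z (0, u z) := by
    have hc : HasFDerivAt (fun y : Space d => ((z.1, y) : SpaceTime d))
        (ContinuousLinearMap.inr ℝ ℝ (Space d)) z.2 := hasFDerivAt_prodMk_right _ _
    have h3 := (HasFDerivAt.comp z.2 (f := fun y : Space d => ((z.1, y) : SpaceTime d))
      h.hasFDerivAt hc).fderiv
    rw [real_inner_comm, spaceGrad, gradient, InnerProductSpace.toDual_symm_apply]
    change fderiv ℝ (φ ∘ fun y : Space d => ((z.1, y) : SpaceTime d)) z.2 (u z) = _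
    rw [h3]
    rfl
  rw [transportOp, h1, h2, ← map_add]
  simp

section Defect

variable {F : Type*} [NormedAddCommGroup F] [NormedSpace ℝ F]

/-- The amount
`∫_0^t ∫ (∂_s φ + uᵀ ∇φ) p dx ds - ∫ φ(t, x) p(t, x) dx + ∫ φ(0, x) p(0, x) dx`
by which `u` fails to satisfy the continuity equation on `[0, t]` when tested against `φ`. The
function `φ` may take values in `ℝ` or in `ℂ`; the integrand `∂_s φ + uᵀ ∇φ` is written as the
derivative of `φ` in the direction `(1, u)`. -/
def continuityDefect (p : SpaceTime d → ℝ) (u : SpaceTime d → Space d) (t : ℝ)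
    (φ : SpaceTime d → F) : F :=
  (∫ z, fderiv ℝ φ z (1, u z) ∂(flowMeasure t p)) - (∫ y : Space d, p (t, y) • φ (t, y))
    + ∫ y : Space d, p (0, y) • φ (0, y)

variable {T : ℝ} {p : SpaceTime d → ℝ} {u : SpaceTime d → Space d}

theorem integral_transportOp_eq {t : ℝ} {φ : SpaceTime d → ℝ}
    (h : ∀ z ∈ openSlab d t, DifferentiableAt ℝ φ z) :
    ∫ z, transportOp u φ z ∂(flowMeasure t p) =
      ∫ z, fderiv ℝ φ z (1, u z) ∂(flowMeasure t p) := by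
  refine integral_congr_ae ?_
  filter_upwards [ae_flowMeasure_mem_openSlab t p] with z hz
  exact transportOp_eq_fderiv (h z hz)

theorem residual_eq_continuityDefect {K : SpaceTime d → ℝ} (hK : Differentiable ℝ K) (t : ℝ)
    (ξ : SpaceTime d) :
    residual K p u t ξ = continuityDefect p u t (fun η => K (ξ - η)) := by
  have hd : Differentiable ℝ fun η => K (ξ - η) :=
    hK.comp (differentiable_const ξ |>.sub differentiable_id)
  rw [residual, continuityDefect, integral_transportOp_eq fun z _ => hd z]
  rfl

theorem continuityDefect_ofReal {t : ℝ} {φ : SpaceTime d → ℝ} (hφ : Differentiable ℝ φ) :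
    continuityDefect p u t (fun z => (φ z : ℂ)) = ((continuityDefect p u t φ : ℝ) : ℂ) := by
  have h : ∀ z v, fderiv ℝ (fun z => (φ z : ℂ)) z v = (fderiv ℝ φ z v : ℂ) := by
    intro z v
    have := (Complex.ofRealCLM.hasFDerivAt.comp z (hφ z).hasFDerivAt).fderiv
    change fderiv ℝ (Complex.ofRealCLM ∘ φ) z v = _
    rw [this]
    rfl
  simp only [continuityDefect, h, Complex.real_smul, ← Complex.ofReal_mul, integral_complex_ofReal]
  push_cast
  rfl

theorem norm_one_prodMk_le (v : Space d) : ‖((1, v) : SpaceTime d)‖ ≤ 1 + ‖v‖ := by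
  rw [Prod.norm_mk]
  simp

theorem aestronglyMeasurable_one_prodMk {μ : Measure (SpaceTime d)}
    (hu : AEStronglyMeasurable u μ) :
    AEStronglyMeasurable (fun z => ((1, u z) : SpaceTime d)) μ :=
  aestronglyMeasurable_const.prodMk hu

/-- The continuity defect is stable under bounded pointwise convergence of functions and of their
derivatives. Only the behaviour on the slab matters, and derivatives only in its interior. -/
theorem tendsto_continuityDefect (hp : FlowAdmissible T p) (hu : Integrable u (flowMeasure T p))
    {t : ℝ} (ht : t ∈ Icc 0 T) {f : ℕ → SpaceTime d → ℝ} {φ : SpaceTime d → ℝ} {C : ℝ}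
    (hf : ∀ n, Continuous (f n)) (hb : ∀ n, ∀ z ∈ slab d T, |f n z| ≤ C)
    (hb' : ∀ n, ∀ z ∈ openSlab d T, ‖fderiv ℝ (f n) z‖ ≤ C)
    (hl : ∀ z ∈ slab d T, Tendsto (fun n => f n z) atTop (𝓝 (φ z)))
    (hl' : ∀ z ∈ openSlab d T, Tendsto (fun n => fderiv ℝ (f n) z) atTop (𝓝 (fderiv ℝ φ z))) :
    Tendsto (fun n => continuityDefect p u t (f n)) atTop (𝓝 (continuityDefect p u t φ)) := by
  have hfin := hp.isFiniteMeasure_flowMeasure_of_le ht.2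
  have hu' := integrable_flowMeasure_of_le ht.2 hu
  have hsub : openSlab d t ⊆ openSlab d T := prod_mono (Ioo_subset_Ioo_right ht.2) subset_rfl
  have hslice : ∀ r ∈ Icc 0 T, Tendsto (fun n => ∫ y : Space d, p (r, y) • f n (r, y)) atTop
      (𝓝 (∫ y : Space d, p (r, y) • φ (r, y))) := by
    intro r hr
    have hmem : ∀ y : Space d, (r, y) ∈ slab d T := fun y => ⟨hr, mem_univ _⟩
    refine tendsto_integral_of_dominated_convergence (fun y => |p (r, y)| * C) (fun n => ?_)
      ((hp.integrable r hr).abs.mul_const C) (fun n => ?_) ?_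
    · exact (hp.integrable r hr).aestronglyMeasurable.smul
        ((hf n).comp (by fun_prop : Continuous fun y : Space d => (r, y))).aestronglyMeasurable
    · refine Eventually.of_forall fun y => ?_
      rw [norm_smul, Real.norm_eq_abs, Real.norm_eq_abs]
      exact mul_le_mul_of_nonneg_left (hb n _ (hmem y)) (abs_nonneg _)
    · exact Eventually.of_forall fun y => (hl _ (hmem y)).const_smul _
  refine Tendsto.add (Tendsto.sub ?_ (hslice t ht)) (hslice 0 ⟨le_rfl, ht.1.trans ht.2⟩)
  refine tendsto_integral_of_dominated_convergence (fun z => C * (1 + ‖u z‖)) (fun n => ?_)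
    (((integrable_const 1).add hu'.norm).const_mul C) (fun n => ?_) ?_
  · exact (ContinuousLinearMap.id ℝ (SpaceTime d →L[ℝ] ℝ)).aestronglyMeasurable_comp₂
      (measurable_fderiv ℝ (f n)).aestronglyMeasurable
      (aestronglyMeasurable_one_prodMk hu'.aestronglyMeasurable)
  · filter_upwards [ae_flowMeasure_mem_openSlab t p] with z hz
    calc ‖fderiv ℝ (f n) z (1, u z)‖ ≤ ‖fderiv ℝ (f n) z‖ * ‖((1, u z) : SpaceTime d)‖ :=
          ContinuousLinearMap.le_opNorm _ _
      _ ≤ C * (1 + ‖u z‖) := by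
          have := hb' n z (hsub hz)
          gcongr
          · exact (norm_nonneg _).trans this
          · exact norm_one_prodMk_le _
  · filter_upwards [ae_flowMeasure_mem_openSlab t p] with z hz
    exact ((ContinuousLinearMap.apply ℝ ℝ ((1, u z) : SpaceTime d)).continuous.tendsto _).comp
      (hl' z (hsub hz))

end Defect

/-! ### Plane waves and the Fourier representation of the defect -/

/-- The plane wave `η ↦ exp (-2 π i ⟨z, η⟩)` of frequency `z` on space-time. Frequencies live in
`WithLp 2 (ℝ × ℝ^d)`, which carries the inner product that `ℝ × ℝ^d` lacks. -/
def planeWave (z : WithLp 2 (SpaceTime d)) (η : SpaceTime d) : ℂ :=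
  𝐞 (-⟪z, WithLp.toLp 2 η⟫_ℝ)

theorem norm_planeWave (z : WithLp 2 (SpaceTime d)) (η : SpaceTime d) : ‖planeWave z η‖ = 1 :=
  Circle.norm_coe _

theorem planeWave_add (z : WithLp 2 (SpaceTime d)) (η ζ : SpaceTime d) :
    planeWave z (η + ζ) = planeWave z η * planeWave z ζ := by
  rw [planeWave, planeWave, planeWave, WithLp.toLp_add, inner_add_right, neg_add,
    AddChar.map_add_eq_mul, Circle.coe_mul]

theorem continuous_toLp : Continuous (WithLp.toLp 2 : SpaceTime d → WithLp 2 (SpaceTime d)) :=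
  WithLp.prod_continuous_toLp 2 ℝ (Space d)

theorem continuous_uncurry_planeWave :
    Continuous fun q : SpaceTime d × WithLp 2 (SpaceTime d) => planeWave q.2 q.1 := by
  refine continuous_induced_dom.comp (Real.continuous_fourierChar.comp ?_)
  exact (continuous_snd.inner (continuous_toLp.comp continuous_fst)).neg

theorem fourier_toLp_eq_integral_planeWave (g : WithLp 2 (SpaceTime d) → ℂ) (η : SpaceTime d) :
    𝓕 g (WithLp.toLp 2 η) = ∫ z, planeWave z η * g z := by
  rw [Real.fourier_eq]
  rfl

theorem fderiv_comp_toLp {G : WithLp 2 (SpaceTime d) → ℂ} {η : SpaceTime d}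
    {G' : WithLp 2 (SpaceTime d) →L[ℝ] ℂ} (hG : HasFDerivAt G G' (WithLp.toLp 2 η))
    (v : SpaceTime d) :
    fderiv ℝ (fun η => G (WithLp.toLp 2 η)) η v = G' (WithLp.toLp 2 v) := by
  have h := HasFDerivAt.comp η (f := (WithLp.prodContinuousLinearEquiv 2 ℝ ℝ (Space d)).symm)
    hG (WithLp.prodContinuousLinearEquiv 2 ℝ ℝ (Space d)).symm.hasFDerivAt
  exact congrArg (fun A : SpaceTime d →L[ℝ] ℂ => A v) h.fderiv

theorem fderiv_planeWave (z : WithLp 2 (SpaceTime d)) (η v : SpaceTime d) :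
    fderiv ℝ (planeWave z) η v =
      -2 * Real.pi * Complex.I * (⟪z, WithLp.toLp 2 v⟫_ℝ : ℂ) * planeWave z η := by
  have h := fderiv_comp_toLp (Real.hasFDerivAt_fourierChar_neg_bilinear_right
    (innerSL ℝ) z (WithLp.toLp 2 η)) v
  refine Eq.trans h ?_
  have hi : innerSL ℝ z (WithLp.toLp 2 v) = ⟪z, WithLp.toLp 2 v⟫_ℝ := rfl
  have hi' : innerSL ℝ z (WithLp.toLp 2 η) = ⟪z, WithLp.toLp 2 η⟫_ℝ := rfl
  simp only [hi, hi', smul_apply, ContinuousLinearMap.comp_apply,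
    Complex.ofRealCLM_apply, smul_eq_mul, planeWave]
  ring

theorem integrable_of_one_add_sq {g : WithLp 2 (SpaceTime d) → ℂ}
    (hm : AEStronglyMeasurable g volume) (h : Integrable fun z => (1 + ‖z‖ ^ 2) * ‖g z‖) :
    Integrable g ∧ Integrable fun z => ‖z‖ * ‖g z‖ := by
  refine ⟨h.mono' hm (Eventually.of_forall fun z => ?_),
    h.mono' (continuous_norm.aestronglyMeasurable.mul hm.norm) (Eventually.of_forall fun z => ?_)⟩
  · nlinarith [sq_nonneg ‖z‖, norm_nonneg (g z), mul_nonneg (sq_nonneg ‖z‖) (norm_nonneg (g z))]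
  · rw [Real.norm_of_nonneg (by positivity)]
    gcongr
    nlinarith [sq_nonneg (‖z‖ - 1)]

theorem fderiv_fourier_toLp {g : WithLp 2 (SpaceTime d) → ℂ} (hg : Integrable g)
    (hg' : Integrable fun z => ‖z‖ * ‖g z‖) (η v : SpaceTime d) :
    fderiv ℝ (fun η => 𝓕 g (WithLp.toLp 2 η)) η v =
      ∫ z, fderiv ℝ (planeWave z) η v * g z := by
  rw [fderiv_comp_toLp (Real.hasFDerivAt_fourier hg hg' _) v, Real.fourier_eq]
  have hi : Integrable (VectorFourier.fourierSMulRight (innerSL ℝ) g) volume := by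
    refine (hg'.const_mul (2 * Real.pi * ‖innerSL ℝ (E := WithLp 2 (SpaceTime d))‖)).mono'
      (hg.1.fourierSMulRight) (Eventually.of_forall fun z => ?_)
    refine (VectorFourier.norm_fourierSMulRight_le _ _ _).trans (le_of_eq ?_)
    ring
  rw [ContinuousLinearMap.integral_apply
    ((Real.fourierIntegral_convergent_iff _).2 hi)]
  refine integral_congr_ae (Eventually.of_forall fun z => ?_)
  have hi' : innerSL ℝ z (WithLp.toLp 2 v) = ⟪z, WithLp.toLp 2 v⟫_ℝ := rfl
  simp only [hi', Circle.smul_def, smul_apply, VectorFourier.fourierSMulRight_apply,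
    fderiv_planeWave, smul_eq_mul, Complex.real_smul, planeWave]
  ring

section Defect

variable {T : ℝ} {p : SpaceTime d → ℝ} {u : SpaceTime d → Space d}

theorem norm_toLp_one_le (v : Space d) :
    ‖(WithLp.toLp 2 (1, v) : WithLp 2 (SpaceTime d))‖ ≤ 1 + ‖v‖ := by
  have h := WithLp.prod_norm_sq_eq_of_L2 (WithLp.toLp 2 (1, v) : WithLp 2 (SpaceTime d))
  change _ = ‖(1 : ℝ)‖ ^ 2 + ‖v‖ ^ 2 at h
  rw [norm_one] at h
  nlinarith [norm_nonneg v, norm_nonneg (WithLp.toLp 2 (1, v) : WithLp 2 (SpaceTime d))]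

theorem norm_fderiv_planeWave_le (z : WithLp 2 (SpaceTime d)) (η : SpaceTime d) (v : Space d) :
    ‖fderiv ℝ (planeWave z) η (1, v)‖ ≤ 2 * Real.pi * ‖z‖ * (1 + ‖v‖) := by
  rw [fderiv_planeWave]
  simp only [norm_mul, norm_planeWave, Complex.norm_I, Complex.norm_real, norm_neg,
    Complex.norm_ofNat, mul_one, Real.norm_eq_abs, abs_of_pos Real.pi_pos]
  have h1 := abs_real_inner_le_norm z (WithLp.toLp 2 (1, v))
  have h2 := norm_toLp_one_le v
  have : |⟪z, WithLp.toLp 2 (1, v)⟫_ℝ| ≤ ‖z‖ * (1 + ‖v‖) :=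
    h1.trans (mul_le_mul_of_nonneg_left h2 (norm_nonneg _))
  calc _ ≤ 2 * Real.pi * (‖z‖ * (1 + ‖v‖)) := by gcongr
    _ = _ := by ring

theorem aestronglyMeasurable_fderiv_planeWave {μ : Measure (SpaceTime d)}
    {ν : Measure (WithLp 2 (SpaceTime d))} [SFinite ν] (hu : AEStronglyMeasurable u μ) :
    AEStronglyMeasurable (fun q : SpaceTime d × WithLp 2 (SpaceTime d) =>
      fderiv ℝ (planeWave q.2) q.1 (1, u q.1)) (μ.prod ν) := by
  simp only [fderiv_planeWave]
  have h1 : AEStronglyMeasurable (fun q : SpaceTime d × WithLp 2 (SpaceTime d) =>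
      (WithLp.toLp 2 (1, u q.1) : WithLp 2 (SpaceTime d))) (μ.prod ν) :=
    continuous_toLp.comp_aestronglyMeasurable (aestronglyMeasurable_one_prodMk hu).comp_fst
  have h2 : AEStronglyMeasurable (fun q : SpaceTime d × WithLp 2 (SpaceTime d) =>
      ⟪q.2, WithLp.toLp 2 (1, u q.1)⟫_ℝ) (μ.prod ν) :=
    continuous_snd.aestronglyMeasurable.inner h1
  exact ((Complex.continuous_ofReal.comp_aestronglyMeasurable h2).const_mul _).mul
    continuous_uncurry_planeWave.aestronglyMeasurable

theorem aestronglyMeasurable_fderiv_planeWave_left {μ : Measure (SpaceTime d)}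
    (hu : AEStronglyMeasurable u μ) (z : WithLp 2 (SpaceTime d)) :
    AEStronglyMeasurable (fun η => fderiv ℝ (planeWave z) η (1, u η)) μ := by
  simp only [fderiv_planeWave]
  have h2 : AEStronglyMeasurable (fun η => ⟪z, WithLp.toLp 2 (1, u η)⟫_ℝ) μ :=
    aestronglyMeasurable_const.inner
      (continuous_toLp.comp_aestronglyMeasurable (aestronglyMeasurable_one_prodMk hu))
  exact ((Complex.continuous_ofReal.comp_aestronglyMeasurable h2).const_mul _).mul
    (continuous_uncurry_planeWave.comp (by fun_prop : Continuous fun η : SpaceTime d =>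
      (η, z))).aestronglyMeasurable

/-- The continuity defect of a Fourier transform is the superposition of the defects of plane
waves. -/
theorem continuityDefect_fourier (hp : FlowAdmissible T p) (hu : Integrable u (flowMeasure T p))
    {t : ℝ} (ht : t ∈ Icc 0 T) {g : WithLp 2 (SpaceTime d) → ℂ} (hg : Integrable g)
    (hg' : Integrable fun z => ‖z‖ * ‖g z‖) :
    continuityDefect p u t (fun η => 𝓕 g (WithLp.toLp 2 η)) =
      ∫ z, continuityDefect p u t (planeWave z) * g z := by
  have hfin := hp.isFiniteMeasure_flowMeasure_of_le ht.2
  have hu' := integrable_flowMeasure_of_le ht.2 hu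
  have hslice : ∀ r ∈ Icc 0 T,
      Integrable (fun z => (∫ y : Space d, p (r, y) • planeWave z (r, y)) * g z) ∧
      ∫ y : Space d, p (r, y) • 𝓕 g (WithLp.toLp 2 (r, y)) =
        ∫ z, (∫ y : Space d, p (r, y) • planeWave z (r, y)) * g z := by
    intro r hr
    have hi : Integrable (fun q : Space d × WithLp 2 (SpaceTime d) =>
        p (r, q.1) • planeWave q.2 (r, q.1) * g q.2) (volume.prod volume) := by
      have h1 : Integrable (fun q : Space d × WithLp 2 (SpaceTime d) =>
          planeWave q.2 (r, q.1) * ((p (r, q.1) : ℂ) * g q.2)) (volume.prod volume) :=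
        ((hp.integrable r hr).ofReal.mul_prod hg).bdd_mul (c := 1)
          (continuous_uncurry_planeWave.comp (by fun_prop :
            Continuous fun q : Space d × WithLp 2 (SpaceTime d) =>
              (((r, q.1) : SpaceTime d), q.2))).aestronglyMeasurable
          (Eventually.of_forall fun q => (norm_planeWave _ _).le)
      refine h1.congr (Eventually.of_forall fun q => ?_)
      simp only [Complex.real_smul]
      ring
    have h2 : ∀ z, ∫ y : Space d, p (r, y) • planeWave z (r, y) * g z =
        (∫ y : Space d, p (r, y) • planeWave z (r, y)) * g z :=
      fun z => integral_mul_const _ _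
    refine ⟨?_, ?_⟩
    · have := hi.integral_prod_right
      simpa only [h2] using this
    · simp only [← h2]
      rw [← integral_integral_swap hi]
      refine integral_congr_ae (Eventually.of_forall fun y => ?_)
      simp only [fourier_toLp_eq_integral_planeWave, ← integral_smul, smul_mul_assoc]
  have hflow : Integrable (fun z => (∫ η, fderiv ℝ (planeWave z) η (1, u η)
        ∂(flowMeasure t p)) * g z) ∧
      ∫ η, fderiv ℝ (fun η => 𝓕 g (WithLp.toLp 2 η)) η (1, u η) ∂(flowMeasure t p) =
        ∫ z, (∫ η, fderiv ℝ (planeWave z) η (1, u η) ∂(flowMeasure t p)) * g z := by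
    have hi : Integrable (fun q : SpaceTime d × WithLp 2 (SpaceTime d) =>
        fderiv ℝ (planeWave q.2) q.1 (1, u q.1) * g q.2) ((flowMeasure t p).prod volume) := by
      have h1 : Integrable (fun q : SpaceTime d × WithLp 2 (SpaceTime d) =>
          (1 + ‖u q.1‖) * (‖q.2‖ * ‖g q.2‖)) ((flowMeasure t p).prod volume) :=
        ((integrable_const (1 : ℝ)).add hu'.norm).mul_prod hg'
      refine (h1.const_mul (2 * Real.pi)).mono'
        ((aestronglyMeasurable_fderiv_planeWave hu'.1).mul hg.1.comp_snd)
        (Eventually.of_forall fun q => ?_)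
      rw [norm_mul]
      calc _ ≤ 2 * Real.pi * ‖q.2‖ * (1 + ‖u q.1‖) * ‖g q.2‖ :=
            mul_le_mul_of_nonneg_right (norm_fderiv_planeWave_le _ _ _) (norm_nonneg _)
        _ = _ := by ring
    have h2 : ∀ z, ∫ η, fderiv ℝ (planeWave z) η (1, u η) * g z ∂(flowMeasure t p) =
        (∫ η, fderiv ℝ (planeWave z) η (1, u η) ∂(flowMeasure t p)) * g z :=
      fun z => integral_mul_const _ _
    refine ⟨?_, ?_⟩
    · have := hi.integral_prod_right
      simpa only [h2] using this
    · simp only [← h2]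
      rw [← integral_integral_swap hi]
      refine integral_congr_ae (Eventually.of_forall fun η => ?_)
      exact fderiv_fourier_toLp hg hg' _ _
  have h0 := hslice 0 ⟨le_rfl, ht.1.trans ht.2⟩
  have h1 := hslice t ht
  have hadd := integral_add (hflow.1.sub h1.1) h0.1
  simp only [Pi.sub_apply] at hadd
  simp only [continuityDefect, sub_mul, add_mul]
  rw [hadd, integral_sub hflow.1 h1.1, hflow.2, h1.2, h0.2]

theorem continuous_continuityDefect_planeWave (hp : FlowAdmissible T p)
    (hu : Integrable u (flowMeasure T p)) {t : ℝ} (ht : t ∈ Icc 0 T) :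
    Continuous fun z => continuityDefect p u t (planeWave z) := by
  have hfin := hp.isFiniteMeasure_flowMeasure_of_le ht.2
  have hu' := integrable_flowMeasure_of_le ht.2 hu
  have hcont : ∀ η : SpaceTime d, Continuous fun z => planeWave z η := fun η =>
    continuous_uncurry_planeWave.comp (by fun_prop :
      Continuous fun z : WithLp 2 (SpaceTime d) => (η, z))
  have hslice : ∀ r ∈ Icc 0 T,
      Continuous fun z => ∫ y : Space d, p (r, y) • planeWave z (r, y) := by
    intro r hr
    refine continuous_of_dominated (bound := fun y => |p (r, y)|) (fun z => ?_) (fun z => ?_)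
      (hp.integrable r hr).abs ?_
    · exact (hp.integrable r hr).aestronglyMeasurable.smul
        (continuous_uncurry_planeWave.comp (by fun_prop : Continuous fun y : Space d =>
          (((r, y) : SpaceTime d), z))).aestronglyMeasurable
    · exact Eventually.of_forall fun y => by
        rw [norm_smul, norm_planeWave, mul_one, Real.norm_eq_abs]
    · exact Eventually.of_forall fun y => by have := hcont (r, y); fun_prop
  refine ((?_ : Continuous _).sub (hslice t ht)).add (hslice 0 ⟨le_rfl, ht.1.trans ht.2⟩)
  rw [continuous_iff_continuousAt]
  intro z₀
  refine continuousAt_of_dominated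
    (bound := fun η => 2 * Real.pi * (‖z₀‖ + 1) * (1 + ‖u η‖))
    (Eventually.of_forall fun z => aestronglyMeasurable_fderiv_planeWave_left hu'.1 z) ?_
    (((integrable_const 1).add hu'.norm).const_mul _) (Eventually.of_forall fun η => ?_)
  · filter_upwards [continuous_norm.continuousAt.eventually_lt
      (continuousAt_const (y := ‖z₀‖ + 1)) (lt_add_one ‖z₀‖)] with z hz
    refine Eventually.of_forall fun η => (norm_fderiv_planeWave_le _ _ _).trans ?_
    gcongr
  · simp only [fderiv_planeWave]
    have := hcont η
    fun_prop

theorem exists_norm_continuityDefect_planeWave_le (hp : FlowAdmissible T p)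
    (hu : Integrable u (flowMeasure T p)) {t : ℝ} (ht : t ∈ Icc 0 T) :
    ∃ C : ℝ, ∀ z, ‖continuityDefect p u t (planeWave z)‖ ≤ C * (1 + ‖z‖) := by
  have hfin := hp.isFiniteMeasure_flowMeasure_of_le ht.2
  have hu' := integrable_flowMeasure_of_le ht.2 hu
  have hslice : ∀ r ∈ Icc 0 T, ∀ z : WithLp 2 (SpaceTime d),
      ‖∫ y : Space d, p (r, y) • planeWave z (r, y)‖ ≤ ∫ y : Space d, |p (r, y)| := by
    intro r hr z
    refine norm_integral_le_of_norm_le (hp.integrable r hr).abs (Eventually.of_forall fun y => ?_)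
    rw [norm_smul, norm_planeWave, mul_one, Real.norm_eq_abs]
  set A := ∫ η, 2 * Real.pi * (1 + ‖u η‖) ∂(flowMeasure t p)
  have hA : ∀ z : WithLp 2 (SpaceTime d),
      ‖∫ η, fderiv ℝ (planeWave z) η (1, u η) ∂(flowMeasure t p)‖ ≤ A * ‖z‖ := by
    intro z
    rw [← integral_mul_const]
    refine norm_integral_le_of_norm_le
      ((((integrable_const 1).add hu'.norm).const_mul _).mul_const _)
      (Eventually.of_forall fun η => (norm_fderiv_planeWave_le _ _ _).trans (le_of_eq ?_))
    ring
  set B := ∫ y : Space d, |p (t, y)|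
  set D := ∫ y : Space d, |p (0, y)|
  have hA0 : 0 ≤ A := integral_nonneg fun η => by positivity
  have hB0 : 0 ≤ B := integral_nonneg fun η => abs_nonneg _
  have hD0 : 0 ≤ D := integral_nonneg fun η => abs_nonneg _
  refine ⟨A + B + D, fun z => ?_⟩
  have h1 := hslice t ht z
  have h2 := hslice 0 ⟨le_rfl, ht.1.trans ht.2⟩ z
  calc _ ≤ A * ‖z‖ + B + D :=
        (norm_add_le _ _).trans (add_le_add ((norm_sub_le _ _).trans (add_le_add (hA z) h1)) h2)
    _ ≤ _ := by nlinarith [norm_nonneg z, mul_nonneg hB0 (norm_nonneg z),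
        mul_nonneg hD0 (norm_nonneg z)]

end Defect

/-! ### The kernel and its Fourier transform -/

section Kernel

variable {K : SpaceTime d → ℝ}

theorem KernelAdmissible.continuous_ofLp (hK : KernelAdmissible K) :
    Continuous fun ξ : WithLp 2 (SpaceTime d) => (K (WithLp.ofLp ξ) : ℂ) :=
  Complex.continuous_ofReal.comp
    (hK.continuous.comp (WithLp.prod_continuous_ofLp 2 ℝ (Space d)))

theorem KernelAdmissible.integrable_ofLp (hK : KernelAdmissible K) :
    Integrable fun ξ : WithLp 2 (SpaceTime d) => (K (WithLp.ofLp ξ) : ℂ) := by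
  have h := (WithLp.volume_preserving_ofLp ℝ (Space d)).integrable_comp_of_integrable hK.integrable
  exact h.ofReal

theorem KernelAdmissible.continuous_kernelFourier (hK : KernelAdmissible K) :
    Continuous (kernelFourier K) :=
  VectorFourier.fourierIntegral_continuous Real.continuous_fourierChar
    (by exact continuous_inner) hK.integrable_ofLp

theorem KernelAdmissible.integrable_kernelFourier (hK : KernelAdmissible K) (hM : KernelMoment K) :
    Integrable (kernelFourier K) ∧ Integrable fun z => ‖z‖ * ‖kernelFourier K z‖ :=
  integrable_of_one_add_sq hK.continuous_kernelFourier.aestronglyMeasurable hM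

theorem KernelAdmissible.eq_fourier (hK : KernelAdmissible K) (hM : KernelMoment K)
    (ξ : SpaceTime d) : (K ξ : ℂ) = 𝓕 (kernelFourier K) (WithLp.toLp 2 (-ξ)) := by
  have h := hK.continuous_ofLp.fourierInv_fourier_eq hK.integrable_ofLp
    (hK.integrable_kernelFourier hM).1
  have h1 := congrFun h (WithLp.toLp 2 ξ)
  rw [Real.fourierInv_eq_fourier_neg] at h1
  exact h1.symm

/-- A kernel whose Fourier transform has a finite first moment is continuously differentiable, and
bounded together with its derivative. -/
theorem KernelAdmissible.contDiff_and_bounded (hK : KernelAdmissible K) (hM : KernelMoment K) :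
    ContDiff ℝ 1 K ∧ ∃ C : ℝ, ∀ ξ, |K ξ| ≤ C ∧ ‖fderiv ℝ K ξ‖ ≤ C := by
  obtain ⟨hi, hi'⟩ := hK.integrable_kernelFourier hM
  set A : SpaceTime d →L[ℝ] WithLp 2 (SpaceTime d) :=
    -((WithLp.prodContinuousLinearEquiv 2 ℝ ℝ (Space d)).symm :
      SpaceTime d →L[ℝ] WithLp 2 (SpaceTime d)) with hA
  have hKA : K = fun ξ => Complex.reCLM (𝓕 (kernelFourier K) (A ξ)) := by
    funext ξ
    have h := congrArg Complex.re (hK.eq_fourier hM ξ)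
    rwa [Complex.ofReal_re] at h
  have hd : ∀ ξ, HasFDerivAt K (Complex.reCLM ∘L
      (𝓕 (VectorFourier.fourierSMulRight (innerSL ℝ) (kernelFourier K)) (A ξ)) ∘L A) ξ := by
    intro ξ
    have h1 := Complex.reCLM.hasFDerivAt.comp ξ
      ((Real.hasFDerivAt_fourier hi hi' (A ξ)).comp ξ A.hasFDerivAt)
    have h2 : Complex.reCLM ∘ 𝓕 (kernelFourier K) ∘ A = K := hKA.symm
    rwa [h2] at h1
  refine ⟨?_, ?_⟩
  · have h1 : ContDiff ℝ ((1 : ℕ∞) : WithTop ℕ∞) (𝓕 (kernelFourier K)) := by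
      refine Real.contDiff_fourier fun n hn => ?_
      have hn' : n ≤ 1 := by exact_mod_cast hn
      interval_cases n
      · simpa using hi.norm
      · simpa using hi'
    rw [hKA]
    exact Complex.reCLM.contDiff.comp (h1.comp A.contDiff)
  · set S := ∫ z, ‖VectorFourier.fourierSMulRight (innerSL ℝ) (kernelFourier K) z‖
    refine ⟨max (∫ z, ‖kernelFourier K z‖) (‖Complex.reCLM‖ * (S * ‖A‖)), fun ξ => ⟨?_, ?_⟩⟩
    · refine le_max_of_le_left ?_
      rw [← Real.norm_eq_abs, ← Complex.norm_real, hK.eq_fourier hM ξ]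
      exact VectorFourier.norm_fourierIntegral_le_integral_norm _ _ _ _ _
    · refine le_max_of_le_right ?_
      rw [(hd ξ).fderiv]
      refine (ContinuousLinearMap.opNorm_comp_le _ _).trans ?_
      gcongr
      refine (ContinuousLinearMap.opNorm_comp_le _ _).trans ?_
      gcongr
      exact VectorFourier.norm_fourierIntegral_le_integral_norm _ _ _ _ _

theorem uniqueDiffOn_slab {T : ℝ} (hT : 0 < T) : UniqueDiffOn ℝ (slab d T) :=
  (uniqueDiffOn_Icc hT).prod uniqueDiffOn_univ

theorem KernelAdmissible.fderiv_sub (hK : KernelAdmissible K) (hM : KernelMoment K)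
    (ξ η : SpaceTime d) : fderiv ℝ (fun η => K (ξ - η)) η = -fderiv ℝ K (ξ - η) := by
  have h1 : HasFDerivAt (fun η : SpaceTime d => ξ - η)
      (-ContinuousLinearMap.id ℝ (SpaceTime d)) η := (hasFDerivAt_id η).const_sub ξ
  have h2 := (((hK.contDiff_and_bounded hM).1.differentiable one_ne_zero (ξ - η)).hasFDerivAt.comp η
    h1).fderiv
  refine Eq.trans h2 ?_
  ext v <;> simp

theorem KernelAdmissible.isCb1 (hK : KernelAdmissible K) (hM : KernelMoment K) {T : ℝ}
    (hT : 0 < T) (ξ : SpaceTime d) : IsCb1 T (fun η => K (ξ - η)) := by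
  obtain ⟨hC1, C, hC⟩ := hK.contDiff_and_bounded hM
  have h : ContDiff ℝ 1 (fun η => K (ξ - η)) := hC1.comp (contDiff_const.sub contDiff_id)
  refine ⟨h.contDiffOn, C, fun z hz => ⟨(hC _).1, ?_⟩⟩
  rw [((h.differentiable one_ne_zero) z).fderivWithin (uniqueDiffOn_slab hT z hz),
    hK.fderiv_sub hM, norm_neg]
  exact (hC _).2

variable {T : ℝ} {p : SpaceTime d → ℝ} {u : SpaceTime d → Space d}

/-- If `u` passes the test against all translates of the kernel, then it passes the test against
all plane waves. With `Λ(z)` the defect of the plane wave of frequency `z`, the defect of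
`K(ξ - ·)` is the value at `ξ` of the inverse Fourier transform of `Λ · K̂`; hence `Λ · K̂ = 0`, and
`Λ = 0` because `Λ` is continuous and `K̂` is nonzero on a dense set. -/
theorem continuityDefect_planeWave_eq_zero (hK : KernelAdmissible K) (hM : KernelMoment K)
    (hp : FlowAdmissible T p) (hu : Integrable u (flowMeasure T p)) {t : ℝ} (ht : t ∈ Icc 0 T)
    (h : ∀ ξ, continuityDefect p u t (fun η => K (ξ - η)) = 0) (z : WithLp 2 (SpaceTime d)) :
    continuityDefect p u t (planeWave z) = 0 := by
  obtain ⟨hi, hi'⟩ := hK.integrable_kernelFourier hM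
  have hC1 := (hK.contDiff_and_bounded hM).1
  set Λ : WithLp 2 (SpaceTime d) → ℂ := fun z => continuityDefect p u t (planeWave z) with hΛ
  have hΛc : Continuous Λ := continuous_continuityDefect_planeWave hp hu ht
  have hprod : Continuous fun z => Λ z * kernelFourier K z :=
    hΛc.mul hK.continuous_kernelFourier
  have hint : Integrable fun z => Λ z * kernelFourier K z := by
    obtain ⟨C, hC⟩ := exists_norm_continuityDefect_planeWave_le hp hu ht
    refine ((hi.norm.add hi').const_mul C).mono' hprod.aestronglyMeasurable
      (Eventually.of_forall fun z => ?_)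
    rw [norm_mul]
    calc _ ≤ C * (1 + ‖z‖) * ‖kernelFourier K z‖ :=
          mul_le_mul_of_nonneg_right (hC z) (norm_nonneg _)
      _ = _ := by simp only [Pi.add_apply]; ring
  have hzero : 𝓕 (fun z => Λ z * kernelFourier K z) = 0 := by
    funext w
    obtain ⟨ξ, rfl⟩ : ∃ ξ : SpaceTime d, w = WithLp.toLp 2 (-ξ) :=
      ⟨-WithLp.ofLp w, by rw [neg_neg]⟩
    have hg : ∀ z, ‖planeWave z (-ξ) * kernelFourier K z‖ = ‖kernelFourier K z‖ := fun z => by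
      rw [norm_mul, norm_planeWave, one_mul]
    have hgm : Continuous fun z => planeWave z (-ξ) * kernelFourier K z :=
      (continuous_uncurry_planeWave.comp (by fun_prop : Continuous
        fun z : WithLp 2 (SpaceTime d) => (-ξ, z))).mul hK.continuous_kernelFourier
    have h1 := continuityDefect_fourier hp hu ht
      (g := fun z => planeWave z (-ξ) * kernelFourier K z)
      (hi.congr' hgm.aestronglyMeasurable (Eventually.of_forall fun z => (hg z).symm))
      (by simpa only [hg] using hi')
    have h2 : (fun η => 𝓕 (fun z => planeWave z (-ξ) * kernelFourier K z) (WithLp.toLp 2 η)) =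
        fun η => ((K (ξ - η) : ℝ) : ℂ) := by
      funext η
      rw [hK.eq_fourier hM, fourier_toLp_eq_integral_planeWave, fourier_toLp_eq_integral_planeWave]
      refine integral_congr_ae (Eventually.of_forall fun z => ?_)
      simp only
      rw [← mul_assoc, ← planeWave_add, neg_sub, sub_eq_add_neg]
    rw [h2, continuityDefect_ofReal (φ := fun η => K (ξ - η)) ((hC1.differentiable one_ne_zero).comp
      ((differentiable_const ξ).sub differentiable_id)), h ξ] at h1
    rw [fourier_toLp_eq_integral_planeWave, Pi.zero_apply, ← Complex.ofReal_zero, h1]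
    refine integral_congr_ae (Eventually.of_forall fun z => ?_)
    simp only [hΛ]
    ring
  have hmul : ∀ z, Λ z * kernelFourier K z = 0 := by
    have hinv := hprod.fourierInv_fourier_eq hint (by rw [hzero]; exact integrable_zero _ _ _)
    intro z
    rw [← congrFun hinv z, hzero, Real.fourierInv_eq]
    simp
  have hdense : Dense (Function.support (kernelFourier K)) := by
    rw [dense_iff_closure_eq]
    exact hK.full_support
  refine congrFun (hΛc.ext_on hdense continuous_const (g := fun _ => 0) fun z hz => ?_) z
  exact (mul_eq_zero.1 (hmul z)).resolve_right hz

/-- If `u` passes the test against all plane waves, then it passes the test against every smooth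
compactly supported function, by Fourier inversion. -/
theorem continuityDefect_eq_zero_of_contDiff (hp : FlowAdmissible T p)
    (hu : Integrable u (flowMeasure T p)) {t : ℝ} (ht : t ∈ Icc 0 T)
    (h : ∀ z, continuityDefect p u t (planeWave z) = 0) {φ : SpaceTime d → ℝ}
    (hφ : ContDiff ℝ ∞ φ) (hc : HasCompactSupport φ) : continuityDefect p u t φ = 0 := by
  set e := WithLp.prodContinuousLinearEquiv 2 ℝ ℝ (Space d)
  have hsm : ContDiff ℝ ∞ fun w : WithLp 2 (SpaceTime d) => ((φ (e w) : ℝ) : ℂ) :=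
    Complex.ofRealCLM.contDiff.comp (hφ.comp e.contDiff)
  have hcs : HasCompactSupport fun w : WithLp 2 (SpaceTime d) => ((φ (e w) : ℝ) : ℂ) :=
    (hc.comp_homeomorph e.toHomeomorph).comp_left (g := ((↑) : ℝ → ℂ)) Complex.ofReal_zero
  set f : SchwartzMap (WithLp 2 (SpaceTime d)) ℂ := hcs.toSchwartzMap hsm
  set g : SchwartzMap (WithLp 2 (SpaceTime d)) ℂ := 𝓕⁻ f
  have hfg : 𝓕 (g : WithLp 2 (SpaceTime d) → ℂ) = f := by
    rw [← SchwartzMap.fourier_coe]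
    exact congrArg _ (FourierTransform.fourier_fourierInv_eq f)
  have h1 := continuityDefect_fourier hp hu ht g.integrable
    (by simpa using g.integrable_pow_mul volume 1)
  have h2 : (fun η => 𝓕 (g : WithLp 2 (SpaceTime d) → ℂ) (WithLp.toLp 2 η)) =
      fun η => ((φ η : ℝ) : ℂ) := by
    rw [hfg]
    rfl
  rw [h2, continuityDefect_ofReal (hφ.differentiable (by simp))] at h1
  simp only [h, zero_mul, integral_zero] at h1
  exact_mod_cast h1

end Kernel

/-! ### From smooth test functions to the class `C_b^1` -/

section TestFunctions

open scoped Convolution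

/-- Instance search does not see through `volume` on a product. -/
instance isAddHaarMeasure_volume : (volume : Measure (SpaceTime d)).IsAddHaarMeasure :=
  inferInstanceAs ((volume : Measure ℝ).prod (volume : Measure (Space d))).IsAddHaarMeasure

theorem norm_convolution_normed_le {F : Type*} [NormedAddCommGroup F] [NormedSpace ℝ F]
    (b : ContDiffBump (0 : SpaceTime d)) {g : SpaceTime d → F} {C : ℝ} (hg : ∀ z, ‖g z‖ ≤ C)
    (z : SpaceTime d) :
    ‖(b.normed volume ⋆[ContinuousLinearMap.lsmul ℝ ℝ, volume] g) z‖ ≤ C := by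
  calc _ ≤ ∫ y, b.normed volume y * C := by
        refine norm_integral_le_of_norm_le (b.integrable_normed.mul_const C)
          (Eventually.of_forall fun y => ?_)
        rw [ContinuousLinearMap.lsmul_apply, norm_smul,
          Real.norm_of_nonneg (b.nonneg_normed y)]
        exact mul_le_mul_of_nonneg_left (hg _) (b.nonneg_normed y)
    _ = C := by rw [integral_mul_const, b.integral_normed, one_mul]

theorem fderiv_convolution_normed (b : ContDiffBump (0 : SpaceTime d)) {φ : SpaceTime d → ℝ}
    (hφ : ContDiff ℝ 1 φ) (hc : HasCompactSupport φ) (z : SpaceTime d) :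
    fderiv ℝ (b.normed volume ⋆[ContinuousLinearMap.lsmul ℝ ℝ, volume] φ) z =
      (b.normed volume ⋆[ContinuousLinearMap.lsmul ℝ ℝ, volume] (fderiv ℝ φ)) z := by
  rw [(hc.hasFDerivAt_convolution_right (ContinuousLinearMap.lsmul ℝ ℝ)
    b.integrable_normed.locallyIntegrable hφ z).fderiv]
  rfl

variable {T : ℝ} {p : SpaceTime d → ℝ} {u : SpaceTime d → Space d}

theorem continuityDefect_eq_zero_of_contDiff_one (hp : FlowAdmissible T p)
    (hu : Integrable u (flowMeasure T p)) {t : ℝ} (ht : t ∈ Icc 0 T)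
    (h : ∀ φ : SpaceTime d → ℝ, ContDiff ℝ ∞ φ → HasCompactSupport φ →
      continuityDefect p u t φ = 0)
    {φ : SpaceTime d → ℝ} (hφ : ContDiff ℝ 1 φ) (hc : HasCompactSupport φ) :
    continuityDefect p u t φ = 0 := by
  have hr : ∀ n : ℕ, (0 : ℝ) < 1 / ((n : ℝ) + 1) := fun n => Nat.one_div_pos_of_nat
  set b : ℕ → ContDiffBump (0 : SpaceTime d) := fun n =>
    ⟨1 / ((n : ℝ) + 1) / 2, 1 / ((n : ℝ) + 1), half_pos (hr n), half_lt_self (hr n)⟩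
  have hb : Tendsto (fun n => (b n).rOut) atTop (𝓝 0) := tendsto_one_div_add_atTop_nhds_zero_nat
  have hφ' : Continuous (fderiv ℝ φ) := hφ.continuous_fderiv one_ne_zero
  obtain ⟨C₁, hC₁⟩ := hc.exists_bound_of_continuous hφ.continuous
  obtain ⟨C₂, hC₂⟩ := (hc.fderiv (𝕜 := ℝ)).exists_bound_of_continuous hφ'
  set f : ℕ → SpaceTime d → ℝ := fun n =>
    (b n).normed volume ⋆[ContinuousLinearMap.lsmul ℝ ℝ, volume] φ
  have hf : ∀ n, ContDiff ℝ ∞ (f n) := fun n =>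
    (b n).hasCompactSupport_normed.contDiff_convolution_left _ (b n).contDiff_normed
      hφ.continuous.locallyIntegrable
  have hfc : ∀ n, HasCompactSupport (f n) := fun n =>
    HasCompactSupport.convolution _ (b n).hasCompactSupport_normed hc
  have hlim := tendsto_continuityDefect hp hu ht (f := f) (φ := φ) (C := max C₁ C₂)
    (fun n => (hf n).continuous)
    (fun n z _ => (norm_convolution_normed_le (b n) hC₁ z).trans (le_max_left _ _))
    (fun n z _ => by
      rw [fderiv_convolution_normed (b n) hφ hc]
      exact (norm_convolution_normed_le (b n) hC₂ z).trans (le_max_right _ _))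
    (fun z _ => ContDiffBump.convolution_tendsto_right_of_continuous hb hφ.continuous z)
    (fun z _ => by
      simp only [f, fderiv_convolution_normed _ hφ hc]
      exact ContDiffBump.convolution_tendsto_right_of_continuous hb hφ' z)
  simp only [h _ (hf _) (hfc _)] at hlim
  exact (tendsto_nhds_unique hlim tendsto_const_nhds)

theorem IsCb1.differentiableAt {φ : SpaceTime d → ℝ} (hφ : IsCb1 T φ) {z : SpaceTime d}
    (hz : z ∈ openSlab d T) : DifferentiableAt ℝ φ z :=
  ((hφ.contDiffOn.differentiableOn one_ne_zero).mono (openSlab_subset_slab T)).differentiableAt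
    ((isOpen_openSlab T).mem_nhds hz)

theorem IsCb1.fderivWithin_eq {φ : SpaceTime d → ℝ} {z : SpaceTime d}
    (hz : z ∈ openSlab d T) : fderivWithin ℝ φ (slab d T) z = fderiv ℝ φ z :=
  fderivWithin_of_mem_nhds (mem_of_superset ((isOpen_openSlab T).mem_nhds hz)
    (openSlab_subset_slab T))

/-- The contraction `(s, x) ↦ (s + δ (T - 2 s), x)` in time towards `T / 2`. For small `δ > 0` it
maps a neighbourhood of the closed slab into the open slab. -/
def timeContraction (T δ : ℝ) (z : SpaceTime d) : SpaceTime d := (z.1 + δ * (T - 2 * z.1), z.2)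

theorem hasFDerivAt_timeContraction (T δ : ℝ) (z : SpaceTime d) :
    HasFDerivAt (timeContraction T δ) (ContinuousLinearMap.id ℝ (SpaceTime d) -
      (2 * δ) • (ContinuousLinearMap.inl ℝ ℝ (Space d) ∘L ContinuousLinearMap.fst ℝ ℝ (Space d)))
      z := by
  have h : (timeContraction T δ : SpaceTime d → SpaceTime d) = fun z =>
      (ContinuousLinearMap.id ℝ (SpaceTime d) - (2 * δ) •
        (ContinuousLinearMap.inl ℝ ℝ (Space d) ∘L ContinuousLinearMap.fst ℝ ℝ (Space d))) z +
        (δ * T, 0) := by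
    funext z
    refine Prod.ext ?_ ?_
    · simp [timeContraction]
      ring
    · simp [timeContraction]
  rw [h]
  exact (ContinuousLinearMap.hasFDerivAt _).add_const _

theorem norm_fderiv_timeContraction_le {δ : ℝ} (hδ : 0 ≤ δ) (hδ' : δ ≤ 1 / 2) :
    ‖ContinuousLinearMap.id ℝ (SpaceTime d) - (2 * δ) •
      (ContinuousLinearMap.inl ℝ ℝ (Space d) ∘L ContinuousLinearMap.fst ℝ ℝ (Space d))‖ ≤ 1 := by
  refine ContinuousLinearMap.opNorm_le_bound _ zero_le_one fun v => ?_
  have hv : (ContinuousLinearMap.id ℝ (SpaceTime d) - (2 * δ) •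
      (ContinuousLinearMap.inl ℝ ℝ (Space d) ∘L ContinuousLinearMap.fst ℝ ℝ (Space d))) v =
      ((1 - 2 * δ) * v.1, v.2) := by
    refine Prod.ext ?_ ?_
    · simp
      ring
    · simp
  rw [hv, one_mul, Prod.norm_mk]
  refine max_le ?_ (norm_snd_le v)
  rw [norm_mul, Real.norm_of_nonneg (by linarith)]
  exact (mul_le_of_le_one_left (norm_nonneg _) (by linarith)).trans (norm_fst_le v)

theorem contDiff_timeContraction (T δ : ℝ) :
    ContDiff ℝ 1 (timeContraction T δ : SpaceTime d → SpaceTime d) := by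
  unfold timeContraction
  fun_prop

theorem timeContraction_mem_openSlab {δ : ℝ} (hδ : 0 < δ) (hδ' : δ ≤ 1 / 3) (hT : 0 < T)
    {z : SpaceTime d} (h1 : -(δ * T) < z.1) (h2 : z.1 < T + δ * T) :
    timeContraction T δ z ∈ openSlab d T := by
  refine ⟨⟨?_, ?_⟩, mem_univ _⟩
  · change 0 < z.1 + δ * (T - 2 * z.1)
    nlinarith [mul_pos (mul_pos hδ hδ) hT, mul_pos hδ hT]
  · change z.1 + δ * (T - 2 * z.1) < T
    nlinarith [mul_pos (mul_pos hδ hδ) hT, mul_pos hδ hT]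

/-- The spatial cutoff `x ↦ ζ(r x)`, at scale `1 / r`, as a function on space-time. -/
def spaceCutoff (ζ : ContDiffBump (0 : Space d)) (r : ℝ) (z : SpaceTime d) : ℝ := ζ (r • z.2)

theorem contDiff_spaceCutoff (ζ : ContDiffBump (0 : Space d)) (r : ℝ) :
    ContDiff ℝ 1 (spaceCutoff ζ r) :=
  ζ.contDiff.comp (contDiff_snd.const_smul r)

theorem exists_norm_fderiv_spaceCutoff_le (ζ : ContDiffBump (0 : Space d)) :
    ∃ C : ℝ, 0 ≤ C ∧ ∀ r z, ‖fderiv ℝ (spaceCutoff ζ r) z‖ ≤ C * |r| := by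
  have hζ : ContDiff ℝ 1 ζ := ζ.contDiff
  obtain ⟨C, hC⟩ := (ζ.hasCompactSupport.fderiv (𝕜 := ℝ)).exists_bound_of_continuous
    (hζ.continuous_fderiv one_ne_zero)
  refine ⟨C, (norm_nonneg _).trans (hC 0), fun r z => ?_⟩
  have h : HasFDerivAt (spaceCutoff ζ r)
      ((fderiv ℝ ζ (r • z.2)) ∘L (r • ContinuousLinearMap.snd ℝ ℝ (Space d))) z :=
    HasFDerivAt.comp z (f := fun z : SpaceTime d => r • z.2)
      ((hζ.differentiable one_ne_zero) _).hasFDerivAt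
      ((ContinuousLinearMap.snd ℝ ℝ (Space d)).hasFDerivAt.const_smul r)
  rw [h.fderiv]
  refine (ContinuousLinearMap.opNorm_comp_le _ _).trans ?_
  rw [norm_smul, Real.norm_eq_abs]
  have h1 := ContinuousLinearMap.norm_snd_le ℝ ℝ (Space d)
  calc _ ≤ C * (|r| * 1) := by
        gcongr
        · exact (norm_nonneg _).trans (hC 0)
        · exact hC _
    _ = C * |r| := by rw [mul_one]

/-- A `C_b^1` function on the closed slab, after a contraction in time by `δ` and a spatial cutoff
at scale `1 / r`, agrees on the slab with a compactly supported `C^1` function on space-time. -/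
theorem IsCb1.exists_contDiff_eqOn {φ : SpaceTime d → ℝ} (hφ : IsCb1 T φ) (hT : 0 < T)
    (ζ : ContDiffBump (0 : Space d)) {δ r : ℝ} (hδ : 0 < δ) (hδ' : δ ≤ 1 / 3) (hr : 0 < r) :
    ∃ f : SpaceTime d → ℝ, ContDiff ℝ 1 f ∧ HasCompactSupport f ∧
      ∀ z ∈ slab d T, f z = spaceCutoff ζ r z * φ (timeContraction T δ z) := by
  have hδT : 0 < δ * T := mul_pos hδ hT
  set b : ContDiffBump (T / 2) :=
    ⟨T / 2, T / 2 + δ * T / 2, half_pos hT, lt_add_of_pos_right _ (half_pos hδT)⟩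
  have hφo : ContDiffOn ℝ 1 φ (openSlab d T) := hφ.contDiffOn.mono (openSlab_subset_slab T)
  refine ⟨fun z => b z.1 * (spaceCutoff ζ r z * φ (timeContraction T δ z)), ?_, ?_, ?_⟩
  · rw [contDiff_iff_contDiffAt]
    intro z
    have hb : ContDiffAt ℝ 1 (fun z : SpaceTime d => b z.1) z :=
      b.contDiff.contDiffAt.comp z contDiffAt_fst
    by_cases hz : -(δ * T) < z.1 ∧ z.1 < T + δ * T
    · have hmem := timeContraction_mem_openSlab hδ hδ' hT hz.1 hz.2
      exact hb.mul ((contDiff_spaceCutoff ζ r).contDiffAt.mul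
        ((hφo.contDiffAt ((isOpen_openSlab T).mem_nhds hmem)).comp z
          (contDiff_timeContraction T δ).contDiffAt))
    · have hz' : z.1 ∉ Metric.closedBall (T / 2) b.rOut := by
        rw [Real.closedBall_eq_Icc]
        rintro ⟨h1, h2⟩
        change T / 2 - (T / 2 + δ * T / 2) ≤ z.1 at h1
        change z.1 ≤ T / 2 + (T / 2 + δ * T / 2) at h2
        exact hz ⟨by linarith, by linarith⟩
      have hev : ∀ᶠ w : SpaceTime d in 𝓝 z, w.1 ∉ Metric.closedBall (T / 2) b.rOut :=
        continuous_fst.continuousAt.eventually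
          (Metric.isClosed_closedBall.isOpen_compl.mem_nhds hz')
      refine (contDiffAt_const (c := (0 : ℝ))).congr_of_eventuallyEq ?_
      filter_upwards [hev] with w hw
      rw [b.zero_of_le_dist (le_of_lt (not_le.1 hw)), zero_mul]
  · refine HasCompactSupport.intro
      ((isCompact_closedBall (T / 2) b.rOut).prod
        (isCompact_closedBall (0 : Space d) (r⁻¹ * ζ.rOut))) fun z hz => ?_
    rw [mem_prod, not_and_or] at hz
    rcases hz with hz | hz
    · rw [b.zero_of_le_dist (le_of_lt (not_le.1 hz)), zero_mul]
    · have : spaceCutoff ζ r z = 0 := by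
        refine ζ.zero_of_le_dist ?_
        rw [mem_closedBall_zero_iff, not_le, inv_mul_lt_iff₀ hr] at hz
        rw [dist_zero_right, norm_smul, Real.norm_of_nonneg hr.le]
        exact hz.le
      rw [this, zero_mul, mul_zero]
  · intro z hz
    have h1 : b z.1 = 1 := by
      refine b.one_of_mem_closedBall ?_
      rw [Real.closedBall_eq_Icc]
      refine ⟨?_, ?_⟩
      · change T / 2 - T / 2 ≤ z.1
        simpa using hz.1.1
      · change z.1 ≤ T / 2 + T / 2
        simpa using hz.1.2
    simp only [h1, one_mul]

/-- A function of class `C_b^1` on the closed slab passes the test against `u` as soon as all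
compactly supported `C^1` functions on space-time do. -/
theorem continuityDefect_eq_zero_of_isCb1 (hT : 0 < T) (hp : FlowAdmissible T p)
    (hu : Integrable u (flowMeasure T p)) {t : ℝ} (ht : t ∈ Icc 0 T)
    (h : ∀ φ : SpaceTime d → ℝ, ContDiff ℝ 1 φ → HasCompactSupport φ →
      continuityDefect p u t φ = 0)
    {φ : SpaceTime d → ℝ} (hφ : IsCb1 T φ) : continuityDefect p u t φ = 0 := by
  set ζ : ContDiffBump (0 : Space d) := ⟨1, 2, one_pos, one_lt_two⟩
  obtain ⟨B, hB0, hB⟩ := exists_norm_fderiv_spaceCutoff_le ζ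
  obtain ⟨C, hC⟩ := hφ.bounded
  have hC0 : 0 ≤ C := (abs_nonneg _).trans (hC 0 ⟨⟨le_rfl, hT.le⟩, mem_univ _⟩).1
  -- A single parameter serves both for the contraction in time and for the cutoff in space.
  set δ : ℕ → ℝ := fun n => 1 / 3 * (1 / ((n : ℝ) + 1))
  have hδ : ∀ n, 0 < δ n := fun n => mul_pos (by norm_num) Nat.one_div_pos_of_nat
  have hδ' : ∀ n, δ n ≤ 1 / 3 := fun n => by
    have : 1 / ((n : ℝ) + 1) ≤ 1 := by
      rw [div_le_one (by positivity)]
      linarith [(Nat.cast_nonneg n : (0 : ℝ) ≤ n)]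
    change 1 / 3 * (1 / ((n : ℝ) + 1)) ≤ 1 / 3
    linarith
  have hδ0 : Tendsto δ atTop (𝓝 0) := by
    have := (tendsto_one_div_add_atTop_nhds_zero_nat (𝕜 := ℝ)).const_mul (1 / 3)
    rwa [mul_zero] at this
  have hδT : ∀ n, 0 < δ n * T := fun n => mul_pos (hδ n) hT
  choose f hf1 hfc hfe using fun n => hφ.exists_contDiff_eqOn hT ζ (hδ n) (hδ' n) (hδ n)
  set A : ℝ → SpaceTime d →L[ℝ] SpaceTime d := fun δ => ContinuousLinearMap.id ℝ (SpaceTime d) -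
    (2 * δ) • (ContinuousLinearMap.inl ℝ ℝ (Space d) ∘L ContinuousLinearMap.fst ℝ ℝ (Space d))
    with hA
  have hmem : ∀ n, ∀ z ∈ slab d T, timeContraction T (δ n) z ∈ openSlab d T := fun n z hz =>
    timeContraction_mem_openSlab (hδ n) (hδ' n) hT (by linarith [hz.1.1, hδT n])
      (by linarith [hz.1.2, hδT n])
  have hfd : ∀ n, ∀ z ∈ openSlab d T, fderiv ℝ (f n) z =
      spaceCutoff ζ (δ n) z • (fderiv ℝ φ (timeContraction T (δ n) z) ∘L A (δ n)) +
        φ (timeContraction T (δ n) z) • fderiv ℝ (spaceCutoff ζ (δ n)) z := by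
    intro n z hz
    have hev : f n =ᶠ[𝓝 z] fun z => spaceCutoff ζ (δ n) z * φ (timeContraction T (δ n) z) := by
      filter_upwards [(isOpen_openSlab T).mem_nhds hz] with w hw
      exact hfe n w (openSlab_subset_slab T hw)
    rw [hev.fderiv_eq]
    exact (((contDiff_spaceCutoff ζ (δ n)).differentiable one_ne_zero z).hasFDerivAt.mul
      ((hφ.differentiableAt (hmem n z (openSlab_subset_slab T hz))).hasFDerivAt.comp z
        (hasFDerivAt_timeContraction T (δ n) z))).fderiv
  have hφb : ∀ z ∈ openSlab d T, |φ z| ≤ C ∧ ‖fderiv ℝ φ z‖ ≤ C := fun z hz => by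
    rw [← IsCb1.fderivWithin_eq hz]
    exact hC z (openSlab_subset_slab T hz)
  have hcut : ∀ n z, |spaceCutoff ζ (δ n) z| ≤ 1 := fun n z =>
    (abs_of_nonneg (ζ.nonneg' (δ n • z.2))).trans_le ζ.le_one
  have hcut1 : ∀ z, Tendsto (fun n => spaceCutoff ζ (δ n) z) atTop (𝓝 1) := by
    intro z
    have h0 : Tendsto (fun n => δ n • z.2) atTop (𝓝 0) := by
      simpa using hδ0.smul_const z.2
    have h1 : ζ (0 : Space d) = 1 := ζ.one_of_mem_closedBall (by simp [ζ])
    have := (ζ.continuous.tendsto (0 : Space d)).comp h0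
    rwa [h1] at this
  have hcontr : ∀ z : SpaceTime d,
      Tendsto (fun n => timeContraction T (δ n) z) atTop (𝓝 z) := by
    intro z
    have h1 : Tendsto (fun n => z.1 + δ n * (T - 2 * z.1)) atTop (𝓝 z.1) := by
      simpa using (hδ0.mul_const (T - 2 * z.1)).const_add z.1
    exact h1.prodMk_nhds tendsto_const_nhds
  have hlim := tendsto_continuityDefect hp hu ht (f := f) (φ := φ) (C := C + C * B)
    (fun n => (hf1 n).continuous)
    (fun n z hz => by
      rw [hfe n z hz, abs_mul]
      calc _ ≤ 1 * C := mul_le_mul (hcut n z) (hφb _ (hmem n z hz)).1 (abs_nonneg _) zero_le_one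
        _ ≤ C + C * B := by linarith [mul_nonneg hC0 hB0])
    (fun n z hz => by
      have hm := hφb _ (hmem n z (openSlab_subset_slab T hz))
      rw [hfd n z hz]
      refine (norm_add_le _ _).trans (add_le_add ?_ ?_)
      · rw [norm_smul]
        calc _ ≤ 1 * (C * 1) := by
              refine mul_le_mul (hcut n z) ((ContinuousLinearMap.opNorm_comp_le _ _).trans ?_)
                (norm_nonneg _) zero_le_one
              exact mul_le_mul hm.2 (norm_fderiv_timeContraction_le (hδ n).le
                ((hδ' n).trans (by norm_num))) (norm_nonneg _) hC0
          _ = C := by ring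
      · rw [norm_smul]
        refine mul_le_mul hm.1 ((hB _ _).trans ?_) (norm_nonneg _) hC0
        rw [abs_of_pos (hδ n)]
        exact mul_le_of_le_one_right hB0 ((hδ' n).trans (by norm_num)))
    (fun z hz => by
      simp only [hfe _ z hz]
      have h1 : Tendsto (fun n => φ (timeContraction T (δ n) z)) atTop (𝓝 (φ z)) :=
        (hφ.contDiffOn.continuousOn z hz).tendsto.comp (tendsto_nhdsWithin_iff.2
          ⟨hcontr z, Eventually.of_forall fun n => openSlab_subset_slab T (hmem n z hz)⟩)
      simpa using (hcut1 z).mul h1)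
    (fun z hz => by
      simp only [hfd _ z hz]
      have hcd : ContDiffOn ℝ 1 φ (openSlab d T) := hφ.contDiffOn.mono (openSlab_subset_slab T)
      have hnhds := (isOpen_openSlab T).mem_nhds hz
      have h1 : Tendsto (fun n => φ (timeContraction T (δ n) z)) atTop (𝓝 (φ z)) :=
        (hcd.continuousOn.continuousAt hnhds).tendsto.comp (hcontr z)
      have h2 : Tendsto (fun n => fderiv ℝ φ (timeContraction T (δ n) z)) atTop
          (𝓝 (fderiv ℝ φ z)) :=
        ((hcd.continuousOn_fderiv_of_isOpen (isOpen_openSlab T) le_rfl).continuousAt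
          hnhds).tendsto.comp (hcontr z)
      have h3 : Tendsto (fun n => A (δ n)) atTop (𝓝 (ContinuousLinearMap.id ℝ (SpaceTime d))) := by
        have hA0 : A 0 = ContinuousLinearMap.id ℝ (SpaceTime d) := by
          ext v <;> simp [hA]
        have hAc : Continuous A :=
          continuous_const.sub ((continuous_const.mul continuous_id).smul continuous_const)
        exact hA0 ▸ (hAc.tendsto 0).comp hδ0
      have h4 : Tendsto (fun n => fderiv ℝ (spaceCutoff ζ (δ n)) z) atTop (𝓝 0) := by
        refine squeeze_zero_norm (fun n => hB (δ n) z) ?_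
        simpa using hδ0.abs.const_mul B
      have h5 : Tendsto (fun n => fderiv ℝ φ (timeContraction T (δ n) z) ∘L A (δ n)) atTop
          (𝓝 (fderiv ℝ φ z ∘L ContinuousLinearMap.id ℝ (SpaceTime d))) := 
        (isBoundedBilinearMap_comp.continuous.tendsto
          (fderiv ℝ φ z, ContinuousLinearMap.id ℝ (SpaceTime d))).comp (h2.prodMk_nhds h3)
      simpa using ((hcut1 z).smul h5).add (h1.smul h4))
  simp only [h _ (hf1 _) (hfc _)] at hlim
  exact tendsto_nhds_unique hlim tendsto_const_nhds

end TestFunctions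

/-! ### Admissible fields and the residual -/

section Residual

variable {T : ℝ} {p : SpaceTime d → ℝ} {u : SpaceTime d → Space d} {K : SpaceTime d → ℝ}

theorem FlowAdmissible.continuousOn_integral_mul (hp : FlowAdmissible T p) {φ : SpaceTime d → ℝ}
    (hφ : Continuous φ) {C : ℝ} (hC : ∀ z, |φ z| ≤ C) :
    ContinuousOn (fun t => ∫ y : Space d, p (t, y) • φ (t, y)) (Icc 0 T) := by
  have hslice : ∀ t, Continuous fun y : Space d => φ (t, y) := fun t => by fun_prop
  have hint : ∀ s ∈ Icc 0 T, ∀ t, Integrable fun y : Space d => p (s, y) • φ (t, y) :=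
    fun s hs t => ((hp.integrable s hs).norm.mul_const C).mono'
      ((hp.integrable s hs).aestronglyMeasurable.smul (hslice t).aestronglyMeasurable)
      (Eventually.of_forall fun y => by
        rw [norm_smul]
        exact mul_le_mul_of_nonneg_left (hC _) (norm_nonneg _))
  intro s hs
  -- Only `p` varies in the first summand below, and only `φ` in the second.
  have h1 : Tendsto (fun t => ∫ y : Space d, (p (t, y) - p (s, y)) • φ (t, y)) (𝓝[Icc 0 T] s)
      (𝓝 0) := by
    have hlim := (hp.continuous_L1 s hs).mul_const C
    rw [zero_mul] at hlim
    refine squeeze_zero_norm' ?_ hlim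
    filter_upwards [self_mem_nhdsWithin] with t ht
    rw [← integral_mul_const]
    refine norm_integral_le_of_norm_le
      (((hp.integrable t ht).sub (hp.integrable s hs)).abs.mul_const C)
      (Eventually.of_forall fun y => ?_)
    rw [norm_smul]
    exact mul_le_mul_of_nonneg_left (hC _) (norm_nonneg _)
  have h2 : Continuous fun t => ∫ y : Space d, p (s, y) • φ (t, y) := by
    refine continuous_of_dominated (bound := fun y => |p (s, y)| * C) (fun t => (hint s hs t).1)
      (fun t => Eventually.of_forall fun y => ?_) ((hp.integrable s hs).abs.mul_const C)
      (Eventually.of_forall fun y => by fun_prop)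
    rw [norm_smul]
    exact mul_le_mul_of_nonneg_left (hC _) (norm_nonneg _)
  have h3 := h1.add (h2.continuousWithinAt (s := Icc 0 T) (x := s)).tendsto
  rw [zero_add] at h3
  refine h3.congr' ?_
  filter_upwards [self_mem_nhdsWithin] with t ht
  rw [← integral_add _ (hint s hs t)]
  · refine integral_congr_ae (Eventually.of_forall fun y => ?_)
    simp only [smul_eq_mul]
    ring
  · refine ((hint t ht t).sub (hint s hs t)).congr (Eventually.of_forall fun y => ?_)
    simp only [Pi.sub_apply, sub_smul]

theorem ae_flowMeasure_fst_ne (T : ℝ) (p : SpaceTime d → ℝ) (t : ℝ) :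
    ∀ᵐ z ∂(flowMeasure T p), z.1 ≠ t := by
  refine (withDensity_absolutelyContinuous _ _).ae_le ?_
  rw [restrict_slab_eq_prod]
  exact Measure.quasiMeasurePreserving_fst.ae
    (ae_restrict_of_ae (Measure.ae_ne (volume : Measure ℝ) t))

theorem continuousOn_integral_flowMeasure {F : SpaceTime d → ℝ}
    (hF : Integrable F (flowMeasure T p)) :
    ContinuousOn (fun t => ∫ z, F z ∂(flowMeasure t p)) (Icc 0 T) := by
  have heq : ∀ t ∈ Icc 0 T, ∫ z, F z ∂(flowMeasure t p) =
      ∫ z, (slab d t).indicator F z ∂(flowMeasure T p) := fun t ht => by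
    rw [flowMeasure_eq_restrict ht.2, integral_indicator (measurableSet_slab t)]
  refine ContinuousOn.congr (fun s _ => ?_) heq
  refine continuousWithinAt_of_dominated (bound := fun z => ‖F z‖)
    (Eventually.of_forall fun t => hF.1.indicator (measurableSet_slab t))
    (Eventually.of_forall fun t => Eventually.of_forall fun z => norm_indicator_le_norm_self _ _)
    hF.norm ?_
  filter_upwards [ae_flowMeasure_fst_ne T p s, ae_flowMeasure_mem_openSlab T p] with z hz hz'
  refine ContinuousAt.continuousWithinAt ?_
  -- As a function of the time horizon, the indicator is locally constant away from `z.1`.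
  rcases lt_or_gt_of_ne hz with h | h
  · refine (continuousAt_const (y := F z)).congr ?_
    filter_upwards [lt_mem_nhds h] with t ht
    rw [indicator_of_mem]
    exact ⟨⟨hz'.1.1.le, ht.le⟩, mem_univ _⟩
  · refine (continuousAt_const (y := (0 : ℝ))).congr ?_
    filter_upwards [gt_mem_nhds h] with t ht
    rw [indicator_of_notMem]
    exact fun hmem => absurd hmem.1.2 (not_le.2 ht)

theorem integrable_fderiv_apply {μ : Measure (SpaceTime d)} [IsFiniteMeasure μ]
    {v : SpaceTime d → Space d} (a : ℝ) (hv : Integrable v μ) {φ : SpaceTime d → ℝ}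
    {C : ℝ} (hC : ∀ z, ‖fderiv ℝ φ z‖ ≤ C) :
    Integrable (fun z => fderiv ℝ φ z (a, v z)) μ := by
  refine (((integrable_const |a|).add hv.norm).const_mul C).mono' ?_
    (Eventually.of_forall fun z => ?_)
  · exact (ContinuousLinearMap.id ℝ (SpaceTime d →L[ℝ] ℝ)).aestronglyMeasurable_comp₂
      (measurable_fderiv ℝ φ).aestronglyMeasurable
      ((aestronglyMeasurable_const (b := a)).prodMk hv.1)
  · refine (ContinuousLinearMap.le_opNorm _ _).trans ?_
    refine mul_le_mul (hC z) ?_ (norm_nonneg _) ((norm_nonneg _).trans (hC z))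
    rw [Prod.norm_mk, Real.norm_eq_abs]
    exact max_le_add_of_nonneg (abs_nonneg _) (norm_nonneg _)

theorem spaceGrad_eq_toDual_symm {φ : SpaceTime d → ℝ} {z : SpaceTime d}
    (h : DifferentiableAt ℝ φ z) :
    spaceGrad φ z = (InnerProductSpace.toDual ℝ (Space d)).symm
      (fderiv ℝ φ z ∘L ContinuousLinearMap.inr ℝ ℝ (Space d)) := by
  rw [spaceGrad, gradient]
  congr 1
  exact (HasFDerivAt.comp z.2 (f := fun y : Space d => ((z.1, y) : SpaceTime d))
    h.hasFDerivAt (hasFDerivAt_prodMk_right _ _)).fderiv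

theorem timeDeriv_eq_fderiv {φ : SpaceTime d → ℝ} {z : SpaceTime d}
    (h : DifferentiableAt ℝ φ z) : timeDeriv φ z = fderiv ℝ φ z (1, 0) := by
  simpa [transportOp] using transportOp_eq_fderiv (u := fun _ => 0) h

theorem inner_spaceGrad_eq_fderiv {φ : SpaceTime d → ℝ} {z : SpaceTime d}
    (h : DifferentiableAt ℝ φ z) (v : Space d) : ⟪v, spaceGrad φ z⟫_ℝ = fderiv ℝ φ z (0, v) := by
  rw [spaceGrad_eq_toDual_symm h, real_inner_comm, InnerProductSpace.toDual_symm_apply]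
  rfl

theorem KernelAdmissible.continuousOn_residual (hK : KernelAdmissible K) (hM : KernelMoment K)
    (hp : FlowAdmissible T p) (hu : Integrable u (flowMeasure T p)) (ξ : SpaceTime d) :
    ContinuousOn (fun t => residual K p u t ξ) (Icc 0 T) := by
  obtain ⟨hC1, C, hC⟩ := hK.contDiff_and_bounded hM
  have hfin := hp.isFiniteMeasure_flowMeasure
  simp only [residual_eq_continuityDefect (hC1.differentiable one_ne_zero)]
  refine ((continuousOn_integral_flowMeasure (integrable_fderiv_apply 1 hu (C := C)
    fun z => ?_)).sub (hp.continuousOn_integral_mul (φ := fun η => K (ξ - η)) ?_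
      fun z => (hC _).1)).add continuousOn_const
  · rw [hK.fderiv_sub hM, norm_neg]
    exact (hC _).2
  · exact hC1.continuous.comp (continuous_const.sub continuous_id)

/-- The velocity fields in `𝒰₀` have zero residual, because translates of the kernel are admissible
test functions. -/
theorem IsAdmissible.residual_eq_zero (hK : KernelAdmissible K) (hM : KernelMoment K) (hT : 0 < T)
    (hu : IsAdmissible T p u) {t : ℝ} (ht : t ∈ Icc 0 T) : residual K p u t = 0 := by
  funext ξ
  have h := hu.continuity_eq _ (hK.isCb1 hM hT ξ) t ht
  rw [residual, ← h, Pi.zero_apply]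
  simp only [mul_comm]
  ring

/-- Conversely, an integrable field with zero residual lies in `𝒰₀`. -/
theorem isAdmissible_of_residual_eq_zero (hK : KernelAdmissible K) (hM : KernelMoment K)
    (hT : 0 < T) (hp : FlowAdmissible T p) (hu : Integrable u (flowMeasure T p))
    (h : ∀ t ∈ Icc 0 T, residual K p u t = 0) : IsAdmissible T p u := by
  have hC1 := (hK.contDiff_and_bounded hM).1
  have hfin := hp.isFiniteMeasure_flowMeasure
  have hsm : ∀ t ∈ Icc 0 T, ∀ φ : SpaceTime d → ℝ, ContDiff ℝ ∞ φ → HasCompactSupport φ →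
      continuityDefect p u t φ = 0 := by
    intro t ht φ hφ hc
    refine continuityDefect_eq_zero_of_contDiff hp hu ht
      (continuityDefect_planeWave_eq_zero hK hM hp hu ht fun ξ => ?_) hφ hc
    rw [← residual_eq_continuityDefect (hC1.differentiable one_ne_zero), h t ht, Pi.zero_apply]
  refine ⟨⟨hu, ?_⟩, ?_⟩
  · obtain ⟨q, hq, hqφ⟩ := hp.weak_timeDeriv
    refine ⟨fun z => -q z, hq.neg, fun φ hφ => ?_⟩
    have hd : Differentiable ℝ φ := hφ.smooth.differentiable (by simp)
    obtain ⟨C, hC⟩ := (hφ.compact.fderiv (𝕜 := ℝ)).exists_bound_of_continuous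
      (hφ.smooth.continuous_fderiv (by simp))
    have hout : ∀ t, t ∉ Ioo 0 T → ∀ y : Space d, φ (t, y) = 0 := fun t ht y =>
      image_eq_zero_of_notMem_tsupport fun hmem => ht (hφ.support hmem).1
    have h0 := hsm T ⟨hT.le, le_rfl⟩ φ hφ.smooth hφ.compact
    simp only [continuityDefect, hout T (by simp), hout 0 (by simp), smul_zero, integral_zero,
      sub_zero, add_zero] at h0
    have h1 := hqφ φ hφ
    rw [← hp.integral_flowMeasure] at h1
    have h2 : ∀ z, ⟪u z, spaceGrad φ z⟫_ℝ = fderiv ℝ φ z (1, u z) - timeDeriv φ z := fun z => by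
      rw [← transportOp_eq_fderiv (hd z), transportOp, add_sub_cancel_left]
    have h3 : Integrable (fun z => timeDeriv φ z) (flowMeasure T p) := by
      simp only [timeDeriv_eq_fderiv (hd _)]
      exact integrable_fderiv_apply 1 (integrable_zero _ (Space d) _) hC
    simp only [h2]
    rw [integral_sub (integrable_fderiv_apply 1 hu hC) h3, h0, h1]
    simp [integral_neg]
  · intro φ hφ t ht
    have h0 := continuityDefect_eq_zero_of_isCb1 hT hp hu ht
      (fun f hf hc => continuityDefect_eq_zero_of_contDiff_one hp hu ht (hsm t ht) hf hc) hφ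
    rw [integral_transportOp_eq fun z hz => hφ.differentiableAt
      (prod_mono (Ioo_subset_Ioo_right ht.2) subset_rfl hz)]
    simp only [continuityDefect, smul_eq_mul] at h0
    simp only [mul_comm (φ _)]
    linarith

end Residual

/-! ### The penalty -/

section Penalty

variable {T : ℝ} {p : SpaceTime d → ℝ} {u : SpaceTime d → Space d} {K : SpaceTime d → ℝ}

/-- Point evaluations are bounded in the norm of the reproducing kernel Hilbert space. -/
theorem exists_enorm_le_rkhsENorm (hK : IsPositiveDefinite K) (ξ : SpaceTime d) :
    ∃ C : ℝ≥0∞, C ≠ ⊤ ∧ ∀ f : SpaceTime d → ℝ, ‖f ξ‖ₑ ≤ C * rkhsENorm K f := by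
  have hF : Fact (kernelMatrix K).PosSemidef := ⟨kernelMatrix_posSemidef hK⟩
  -- The summand `1` only serves to make the constant nonzero.
  set c : ℝ := √‖RKHS.kernel (RKHS.OfKernel (kernelMatrix K)) ξ ξ‖ + 1 with hc
  have hc0 : 0 < c := by positivity
  refine ⟨ENNReal.ofReal c, ENNReal.ofReal_ne_top, fun f => ?_⟩
  have hne : ENNReal.ofReal c ≠ 0 := by simpa using hc0
  rw [rkhsENorm, ENNReal.mul_iInf_of_ne hne ENNReal.ofReal_ne_top]
  refine le_iInf fun _ => ?_
  rw [ENNReal.mul_iInf_of_ne hne ENNReal.ofReal_ne_top]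
  refine le_iInf fun h => ?_
  rw [ENNReal.mul_iInf_of_ne hne ENNReal.ofReal_ne_top]
  refine le_iInf fun hf => ?_
  rw [← hf, ← ofReal_norm, ← ofReal_norm, ← ENNReal.ofReal_mul hc0.le]
  refine ENNReal.ofReal_le_ofReal ((RKHS.norm_apply_le h ξ).trans ?_)
  rw [mul_comm]
  exact mul_le_mul_of_nonneg_right (by rw [hc]; linarith) (norm_nonneg _)

theorem rkhsENorm_zero (hK : IsPositiveDefinite K) : rkhsENorm K 0 = 0 := by
  have hF : Fact (kernelMatrix K).PosSemidef := ⟨kernelMatrix_posSemidef hK⟩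
  refine le_antisymm ?_ zero_le
  refine (iInf_le _ hF).trans ((iInf_le _ 0).trans ((iInf_le _ RKHS.coe_zero).trans ?_))
  simp

theorem IsAdmissible.objective_eq (hK : KernelAdmissible K) (hM : KernelMoment K) (hT : 0 < T)
    (hu : IsAdmissible T p u) (lam : ℝ) : objective K T p lam u = kineticEnergy T p u := by
  have h : penalty K T p u = 0 := by
    rw [penalty, setLIntegral_congr_fun (g := fun _ => 0) measurableSet_Icc fun t ht => ?_]
    · simp
    · simp only [hu.residual_eq_zero hK hM hT ht, rkhsENorm_zero hK.posDef]
      simp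
  rw [objective, h, mul_zero, add_zero]

theorem penalizedValue_le_value0 (hK : KernelAdmissible K) (hM : KernelMoment K) (hT : 0 < T)
    (lam : ℝ) : penalizedValue K T p lam ≤ value0 T p := by
  refine le_iInf₂ fun u hu => ?_
  rw [← hu.objective_eq hK hM hT lam]
  exact iInf₂_le u hu.isVelocity

theorem exists_lintegral_residual_le (hK : IsPositiveDefinite K) (ξ : SpaceTime d) :
    ∃ C : ℝ≥0∞, C ≠ ⊤ ∧ ∀ u : SpaceTime d → Space d,
      ∫⁻ t in Icc 0 T, ‖residual K p u t ξ‖ₑ ^ 2 ≤ C * penalty K T p u := by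
  obtain ⟨C, hC, h⟩ := exists_enorm_le_rkhsENorm hK ξ
  refine ⟨C ^ 2, ENNReal.pow_ne_top hC, fun u => ?_⟩
  rw [penalty, ← lintegral_const_mul' _ _ (ENNReal.pow_ne_top hC)]
  refine lintegral_mono fun t => ?_
  rw [← mul_pow]
  gcongr
  exact h _

/-- If the penalties of `v n` tend to zero and the residuals of `v n` converge pointwise to that
of `w`, then the residual of `w` vanishes. Each point `ξ` is treated separately, as a function of
time: measurability of the norms `‖H_t‖` in `t` is then not needed. -/
theorem residual_eq_zero_of_tendsto (hK : KernelAdmissible K) (hM : KernelMoment K) (hT : 0 < T)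
    (hp : FlowAdmissible T p) {v : ℕ → SpaceTime d → Space d} {w : SpaceTime d → Space d}
    (hv : ∀ n, Integrable (v n) (flowMeasure T p)) (hw : Integrable w (flowMeasure T p))
    (hpen : Tendsto (fun n => penalty K T p (v n)) atTop (𝓝 0))
    (hlim : ∀ t ∈ Icc 0 T, ∀ ξ,
      Tendsto (fun n => residual K p (v n) t ξ) atTop (𝓝 (residual K p w t ξ))) :
    ∀ t ∈ Icc 0 T, residual K p w t = 0 := by
  have key : ∀ ξ, EqOn (fun t => residual K p w t ξ) (fun _ => 0) (Icc 0 T) := by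
    intro ξ
    obtain ⟨C, hC, hCv⟩ := exists_lintegral_residual_le (T := T) (p := p) hK.posDef ξ
    have hmeas : ∀ n, AEMeasurable (fun t => ‖residual K p (v n) t ξ‖ₑ ^ 2)
        (volume.restrict (Icc 0 T)) := fun n =>
      ((hK.continuousOn_residual hM hp (hv n) ξ).aemeasurable measurableSet_Icc).enorm.pow_const 2
    have hmeasw : AEMeasurable (fun t => ‖residual K p w t ξ‖ₑ ^ 2)
        (volume.restrict (Icc 0 T)) :=
      ((hK.continuousOn_residual hM hp hw ξ).aemeasurable measurableSet_Icc).enorm.pow_const 2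
    have hzero : ∫⁻ t in Icc 0 T, ‖residual K p w t ξ‖ₑ ^ 2 = 0 := by
      refine le_antisymm ?_ zero_le
      have h1 : Tendsto (fun n => C * penalty K T p (v n)) atTop (𝓝 0) := by
        simpa using ENNReal.Tendsto.const_mul hpen (Or.inr hC)
      calc ∫⁻ t in Icc 0 T, ‖residual K p w t ξ‖ₑ ^ 2
          = ∫⁻ t in Icc 0 T, liminf (fun n => ‖residual K p (v n) t ξ‖ₑ ^ 2) atTop := by
            refine setLIntegral_congr_fun measurableSet_Icc fun t ht => ?_
            exact (((ENNReal.continuous_pow 2).tendsto _).comp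
              (hlim t ht ξ).enorm).liminf_eq.symm
        _ ≤ liminf (fun n => ∫⁻ t in Icc 0 T, ‖residual K p (v n) t ξ‖ₑ ^ 2) atTop :=
            lintegral_liminf_le' hmeas
        _ ≤ liminf (fun n => C * penalty K T p (v n)) atTop :=
            liminf_le_liminf (Eventually.of_forall fun n => hCv (v n))
        _ = 0 := h1.liminf_eq
    refine Measure.eqOn_Icc_of_ae_eq volume hT.ne ?_ (hK.continuousOn_residual hM hp hw ξ)
      continuousOn_const
    filter_upwards [(lintegral_eq_zero_iff' hmeasw).1 hzero] with t ht
    simpa using ht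
  intro t ht
  funext ξ
  exact key ξ ht

end Penalty

/-! ### Weak and strong convergence in Hilbert space -/

section HilbertSpace

variable {H : Type*} [NormedAddCommGroup H] [InnerProductSpace ℝ H]

theorem exists_subseq_tendsto_inner [CompleteSpace H] [TopologicalSpace.SeparableSpace H]
    {x : ℕ → H} {R : ℝ}
    (hx : ∀ n, ‖x n‖ ≤ R) :
    ∃ a : H, ∃ ms : ℕ → ℕ, StrictMono ms ∧
      ∀ y, Tendsto (fun n => ⟪x (ms n), y⟫_ℝ) atTop (𝓝 ⟪a, y⟫_ℝ) := by
  set f : ℕ → WeakDual ℝ H := fun n =>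
    StrongDual.toWeakDual (InnerProductSpace.toDual ℝ H (x n))
  have hf : ∀ n, f n ∈ WeakDual.toStrongDual ⁻¹' Metric.closedBall (0 : StrongDual ℝ H) R := by
    intro n
    rw [mem_preimage, mem_closedBall_zero_iff]
    refine le_trans (le_of_eq ?_) (hx n)
    exact (InnerProductSpace.toDual ℝ H).norm_map (x n)
  obtain ⟨g, -, ms, hms, hlim⟩ := WeakDual.isSeqCompact_closedBall ℝ H 0 R hf
  refine ⟨(InnerProductSpace.toDual ℝ H).symm (WeakDual.toStrongDual g), ms, hms, fun y => ?_⟩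
  rw [InnerProductSpace.toDual_symm_apply]
  exact ((WeakDual.eval_continuous y).tendsto g).comp hlim

/-- A weakly convergent sequence whose norms are asymptotically at most the norm of the limit
converges strongly. -/
theorem tendsto_of_tendsto_inner_of_norm_sq_le {x : ℕ → H} {a : H} {V : ℝ} {ε : ℕ → ℝ}
    (hx : ∀ y, Tendsto (fun n => ⟪x n, y⟫_ℝ) atTop (𝓝 ⟪a, y⟫_ℝ)) (hε : Tendsto ε atTop (𝓝 0))
    (hn : ∀ n, ‖x n‖ ^ 2 ≤ V + ε n) (hV : V ≤ ‖a‖ ^ 2) :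
    Tendsto x atTop (𝓝 a) ∧ ‖a‖ ^ 2 = V := by
  have hle : ∀ n, ‖x n - a‖ ^ 2 ≤ V + ε n - 2 * ⟪x n, a⟫_ℝ + ‖a‖ ^ 2 := fun n => by
    rw [norm_sub_sq_real]
    linarith [hn n]
  have hlim : Tendsto (fun n => V + ε n - 2 * ⟪x n, a⟫_ℝ + ‖a‖ ^ 2) atTop
      (𝓝 (V + 0 - 2 * ⟪a, a⟫_ℝ + ‖a‖ ^ 2)) :=
    ((hε.const_add V).sub ((hx a).const_mul 2)).add_const _
  have hval : V + 0 - 2 * ⟪a, a⟫_ℝ + ‖a‖ ^ 2 = V - ‖a‖ ^ 2 := by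
    rw [real_inner_self_eq_norm_sq]
    ring
  rw [hval] at hlim
  have hge : 0 ≤ V - ‖a‖ ^ 2 :=
    ge_of_tendsto' hlim fun n => (sq_nonneg ‖x n - a‖).trans (hle n)
  have heq : ‖a‖ ^ 2 = V := by linarith
  rw [show V - ‖a‖ ^ 2 = 0 by linarith] at hlim
  refine ⟨?_, heq⟩
  have h2 : Tendsto (fun n => ‖x n - a‖ ^ 2) atTop (𝓝 0) :=
    squeeze_zero (fun n => sq_nonneg _) hle hlim
  rw [tendsto_iff_norm_sub_tendsto_zero]
  simpa using h2.sqrt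

end HilbertSpace

/-! ### Almost minimizers of the penalized problems -/

section Minimizers

variable {T : ℝ} {p : SpaceTime d → ℝ} {u : SpaceTime d → Space d} {K : SpaceTime d → ℝ}

theorem kineticEnergy_eq_eLpNorm_sq (T : ℝ) (p : SpaceTime d → ℝ) (u : SpaceTime d → Space d) :
    kineticEnergy T p u = eLpNorm u 2 (flowMeasure T p) ^ 2 := by
  have h := eLpNorm_nnreal_pow_eq_lintegral (f := u) (μ := flowMeasure T p)
    (two_ne_zero : (2 : NNReal) ≠ 0)
  simp only [NNReal.coe_ofNat, ENNReal.coe_ofNat, ENNReal.rpow_ofNat] at h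
  exact h.symm

theorem memLp_two_of_kineticEnergy_ne_top (hu : AEStronglyMeasurable u (flowMeasure T p))
    (h : kineticEnergy T p u ≠ ⊤) : MemLp u 2 (flowMeasure T p) := by
  refine ⟨hu, lt_top_iff_ne_top.2 fun htop => h ?_⟩
  rw [kineticEnergy_eq_eLpNorm_sq, htop]
  rfl

theorem kineticEnergy_eq_ofReal_norm_toLp_sq (hu : MemLp u 2 (flowMeasure T p)) :
    kineticEnergy T p u = ENNReal.ofReal (‖hu.toLp u‖ ^ 2) := by
  rw [kineticEnergy_eq_eLpNorm_sq, ENNReal.ofReal_pow (norm_nonneg _), ofReal_norm, Lp.enorm_toLp]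

theorem memLp_indicator_spaceGrad (hK : KernelAdmissible K) (hM : KernelMoment K)
    (hp : FlowAdmissible T p) (t : ℝ) (ξ : SpaceTime d) :
    MemLp ((slab d t).indicator (spaceGrad fun η => K (ξ - η))) 2 (flowMeasure T p) := by
  have hfin := hp.isFiniteMeasure_flowMeasure
  obtain ⟨hC1, C, hC⟩ := hK.contDiff_and_bounded hM
  have hd : ContDiff ℝ 1 fun η => K (ξ - η) := hC1.comp (contDiff_const.sub contDiff_id)
  have heq : (spaceGrad fun η => K (ξ - η)) = fun z =>
      (InnerProductSpace.toDual ℝ (Space d)).symm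
        (fderiv ℝ (fun η => K (ξ - η)) z ∘L ContinuousLinearMap.inr ℝ ℝ (Space d)) := by
    funext z
    exact spaceGrad_eq_toDual_symm (hd.differentiable one_ne_zero z)
  have hc : Continuous (spaceGrad fun η => K (ξ - η)) := by
    rw [heq]
    exact (InnerProductSpace.toDual ℝ (Space d)).symm.continuous.comp
      ((hd.continuous_fderiv one_ne_zero).clm_comp continuous_const)
  refine MemLp.indicator (measurableSet_slab t)
    (MemLp.of_bound hc.aestronglyMeasurable (C * 1) (Eventually.of_forall fun z => ?_))
  rw [heq, LinearIsometryEquiv.norm_map]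
  refine (ContinuousLinearMap.opNorm_comp_le _ _).trans ?_
  rw [hK.fderiv_sub hM, norm_neg]
  exact mul_le_mul (hC _).2 (ContinuousLinearMap.norm_inr_le_one ℝ ℝ (Space d)) (norm_nonneg _)
    ((abs_nonneg _).trans (hC 0).1)

/-- The residual at a point is an affine, weakly continuous function of the velocity field
in `L²`. -/
theorem residual_sub_residual_eq_inner (hK : KernelAdmissible K) (hM : KernelMoment K)
    (hp : FlowAdmissible T p) {t : ℝ} (ht : t ∈ Icc 0 T) (ξ : SpaceTime d)
    (hu : MemLp u 2 (flowMeasure T p)) :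
    residual K p u t ξ - residual K p 0 t ξ =
      ⟪hu.toLp u, (memLp_indicator_spaceGrad hK hM hp t ξ).toLp _⟫_ℝ := by
  have hfin := hp.isFiniteMeasure_flowMeasure
  have hfin' := hp.isFiniteMeasure_flowMeasure_of_le ht.2
  obtain ⟨hC1, C, hC⟩ := hK.contDiff_and_bounded hM
  have hd : Differentiable ℝ fun η => K (ξ - η) :=
    (hC1.comp (contDiff_const.sub contDiff_id)).differentiable one_ne_zero
  have hb : ∀ z, ‖fderiv ℝ (fun η => K (ξ - η)) z‖ ≤ C := fun z => by
    rw [hK.fderiv_sub hM, norm_neg]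
    exact (hC _).2
  have hu1 : Integrable u (flowMeasure t p) :=
    integrable_flowMeasure_of_le ht.2 (hu.integrable one_le_two)
  have h1 : residual K p u t ξ - residual K p 0 t ξ =
      ∫ z, ⟪u z, spaceGrad (fun η => K (ξ - η)) z⟫_ℝ ∂(flowMeasure t p) := by
    simp only [residual, transportOp_eq_fderiv (hd _)]
    have h2 := integral_sub (integrable_fderiv_apply 1 hu1 hb)
      (integrable_fderiv_apply 1 (integrable_zero _ (Space d) (flowMeasure t p)) hb)
    calc _ = _ := by ring
      _ = _ := h2.symm
      _ = _ := by
        refine integral_congr_ae (Eventually.of_forall fun z => ?_)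
        simp only
        rw [inner_spaceGrad_eq_fderiv (hd z), ← map_sub]
        simp
  rw [h1, L2.inner_def, flowMeasure_eq_restrict ht.2, ← integral_indicator (measurableSet_slab t)]
  refine integral_congr_ae ?_
  filter_upwards [hu.coeFn_toLp, (memLp_indicator_spaceGrad hK hM hp t ξ).coeFn_toLp] with z h2 h3
  rw [h2, h3]
  by_cases hz : z ∈ slab d t
  · rw [indicator_of_mem hz, indicator_of_mem hz]
  · rw [indicator_of_notMem hz, indicator_of_notMem hz, inner_zero_right]

theorem tendsto_penalty_zero {v : ℕ → SpaceTime d → Space d} {lam : ℕ → ℝ}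
    (hlam : Tendsto lam atTop atTop) {B : ℝ≥0∞} (hB : B ≠ ⊤)
    (hobj : ∀ n, objective K T p (lam n) (v n) ≤ B) :
    Tendsto (fun n => penalty K T p (v n)) atTop (𝓝 0) := by
  have h1 : Tendsto (fun n => B / ENNReal.ofReal (lam n)) atTop (𝓝 0) := by
    simpa using ENNReal.Tendsto.const_div (ENNReal.tendsto_ofReal_atTop.comp hlam) (Or.inr hB)
  refine tendsto_of_tendsto_of_tendsto_of_le_of_le' tendsto_const_nhds h1
    (Eventually.of_forall fun n => zero_le) ?_
  filter_upwards [hlam.eventually_gt_atTop 0] with n hn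
  rw [ENNReal.le_div_iff_mul_le (Or.inl (by simpa using hn)) (Or.inl ENNReal.ofReal_ne_top),
    mul_comm]
  exact le_add_self.trans (hobj n)

/-- Compactness of almost minimizers: a sequence of velocity fields whose penalized objectives, for
weights tending to infinity, asymptotically do not exceed `V₀(μ)` has a subsequence that converges
in `L²(p dt dx)` to a minimizer of the all-time optimal transport problem. -/
theorem exists_subseq_tendsto_minimizer (hK : KernelAdmissible K) (hM : KernelMoment K)
    (hT : 0 < T) (hp : FlowAdmissible T p) (hV : value0 T p < ⊤)
    {v : ℕ → SpaceTime d → Space d} {ε lam : ℕ → ℝ}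
    (hv : ∀ n, IsVelocity T p (v n)) (hε : ∀ n, 0 < ε n) (hε0 : Tendsto ε atTop (𝓝 0))
    (hlam : Tendsto lam atTop atTop)
    (hobj : ∀ n, objective K T p (lam n) (v n) ≤ value0 T p + ENNReal.ofReal (ε n)) :
    ∃ ms : ℕ → ℕ, ∃ w, IsAdmissible T p w ∧ kineticEnergy T p w = value0 T p ∧
      Tendsto (fun n => eLpNorm (v (ms n) - w) 2 (flowMeasure T p)) atTop (𝓝 0) ∧
      Tendsto (fun n => kineticEnergy T p (v (ms n))) atTop (𝓝 (value0 T p)) := by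
  have hfin := hp.isFiniteMeasure_flowMeasure
  have hsep := isSeparable_of_sigmaFinite (flowMeasure T p)
  have h2top : Fact ((2 : ℝ≥0∞) ≠ ⊤) := ⟨ENNReal.ofNat_ne_top⟩
  obtain ⟨B, hB⟩ := hε0.bddAbove_range
  have hεB : ∀ n, ε n ≤ B := fun n => hB ⟨n, rfl⟩
  set V : ℝ := (value0 T p).toReal with hVdef
  have hV0 : 0 ≤ V := ENNReal.toReal_nonneg
  have hVeq : value0 T p = ENNReal.ofReal V := (ENNReal.ofReal_toReal hV.ne).symm
  have hkin : ∀ n, kineticEnergy T p (v n) ≤ ENNReal.ofReal (V + ε n) := fun n => by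
    rw [ENNReal.ofReal_add hV0 (hε n).le, ← hVeq]
    exact le_self_add.trans (hobj n)
  have hmem : ∀ n, MemLp (v n) 2 (flowMeasure T p) := fun n =>
    memLp_two_of_kineticEnergy_ne_top (hv n).integrable.1
      (ne_top_of_le_ne_top ENNReal.ofReal_ne_top (hkin n))
  set x : ℕ → Lp (Space d) 2 (flowMeasure T p) := fun n => (hmem n).toLp (v n) with hx
  have hxn : ∀ n, ‖x n‖ ^ 2 ≤ V + ε n := fun n => by
    have := hkin n
    rwa [kineticEnergy_eq_ofReal_norm_toLp_sq (hmem n),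
      ENNReal.ofReal_le_ofReal_iff (add_nonneg hV0 (hε n).le)] at this
  obtain ⟨a, ms, hms, hweak⟩ := exists_subseq_tendsto_inner (x := x) (R := √(V + B)) fun n =>
    Real.le_sqrt_of_sq_le ((hxn n).trans (add_le_add_right (hεB n) V))
  have hamem : MemLp a 2 (flowMeasure T p) := Lp.memLp a
  have haeq : hamem.toLp a = a := Lp.toLp_coeFn a hamem
  have hres : ∀ t ∈ Icc 0 T, residual K p a t = 0 := by
    refine residual_eq_zero_of_tendsto hK hM hT hp (v := fun n => v (ms n))
      (fun n => (hv _).integrable) (hamem.integrable one_le_two) ?_ fun t ht ξ => ?_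
    · refine tendsto_penalty_zero (hlam.comp hms.tendsto_atTop)
        (B := value0 T p + ENNReal.ofReal B) (by simp [hV.ne]) fun n => (hobj (ms n)).trans ?_
      gcongr
      exact hεB _
    · have h := (hweak ((memLp_indicator_spaceGrad hK hM hp t ξ).toLp _)).add_const
        (residual K p 0 t ξ)
      rw [← haeq] at h
      simp only [hx, ← residual_sub_residual_eq_inner hK hM hp ht ξ, sub_add_cancel] at h
      exact h
  have hadm : IsAdmissible T p a :=
    isAdmissible_of_residual_eq_zero hK hM hT hp (hamem.integrable one_le_two) hres
  have hkina : kineticEnergy T p a = ENNReal.ofReal (‖a‖ ^ 2) := by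
    rw [kineticEnergy_eq_ofReal_norm_toLp_sq hamem, haeq]
  have hVa : V ≤ ‖a‖ ^ 2 := by
    have : value0 T p ≤ kineticEnergy T p a := iInf₂_le _ hadm
    rwa [hVeq, hkina, ENNReal.ofReal_le_ofReal_iff (sq_nonneg _)] at this
  obtain ⟨hstrong, hnorm⟩ := tendsto_of_tendsto_inner_of_norm_sq_le hweak
    (hε0.comp hms.tendsto_atTop) (fun n => hxn (ms n)) hVa
  refine ⟨ms, a, hadm, by rw [hkina, hnorm, hVeq], ?_, ?_⟩
  · have h1 : ∀ n, eLpNorm (v (ms n) - ⇑a) 2 (flowMeasure T p) = ‖x (ms n) - a‖ₑ := fun n => by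
      rw [← Lp.enorm_toLp ((hmem (ms n)).sub hamem), MemLp.toLp_sub (hmem _) hamem, haeq]
    simp only [h1]
    have h2 := (hstrong.sub_const a).enorm
    rwa [sub_self, enorm_zero] at h2
  · simp only [kineticEnergy_eq_ofReal_norm_toLp_sq (hmem _)]
    rw [hVeq, ← hnorm]
    exact (ENNReal.continuous_ofReal.tendsto _).comp (hstrong.norm.pow 2)

theorem tendsto_kineticEnergy_value0 (hK : KernelAdmissible K) (hM : KernelMoment K)
    (hT : 0 < T) (hp : FlowAdmissible T p) (hV : value0 T p < ⊤)
    {v : ℕ → SpaceTime d → Space d} {ε lam : ℕ → ℝ}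
    (hv : ∀ n, IsVelocity T p (v n)) (hε : ∀ n, 0 < ε n) (hε0 : Tendsto ε atTop (𝓝 0))
    (hlam : Tendsto lam atTop atTop)
    (hobj : ∀ n, objective K T p (lam n) (v n) ≤ value0 T p + ENNReal.ofReal (ε n)) :
    Tendsto (fun n => kineticEnergy T p (v n)) atTop (𝓝 (value0 T p)) := by
  refine tendsto_of_subseq_tendsto fun ns hns => ?_
  obtain ⟨ms, -, -, -, -, h⟩ := exists_subseq_tendsto_minimizer hK hM hT hp hV
    (fun n => hv (ns n)) (fun n => hε (ns n)) (hε0.comp hns) (hlam.comp hns)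
    fun n => hobj (ns n)
  exact ⟨ms, h⟩

theorem tendsto_objective_value0 (hK : KernelAdmissible K) (hM : KernelMoment K)
    (hT : 0 < T) (hp : FlowAdmissible T p) (hV : value0 T p < ⊤)
    {v : ℕ → SpaceTime d → Space d} {ε lam : ℕ → ℝ}
    (hv : ∀ n, IsVelocity T p (v n)) (hε : ∀ n, 0 < ε n) (hε0 : Tendsto ε atTop (𝓝 0))
    (hlam : Tendsto lam atTop atTop)
    (hobj : ∀ n, objective K T p (lam n) (v n) ≤ value0 T p + ENNReal.ofReal (ε n)) :
    Tendsto (fun n => objective K T p (lam n) (v n)) atTop (𝓝 (value0 T p)) := by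
  have h1 : Tendsto (fun n => value0 T p + ENNReal.ofReal (ε n)) atTop (𝓝 (value0 T p)) := by
    have := (ENNReal.tendsto_ofReal hε0).const_add (value0 T p)
    rwa [ENNReal.ofReal_zero, add_zero] at this
  exact tendsto_of_tendsto_of_tendsto_of_le_of_le
    (tendsto_kineticEnergy_value0 hK hM hT hp hV hv hε hε0 hlam hobj) h1
    (fun n => le_self_add) hobj

theorem value0_eq_iSup_penalizedValue (hK : KernelAdmissible K) (hM : KernelMoment K)
    (hT : 0 < T) (hp : FlowAdmissible T p) (hV : value0 T p < ⊤) :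
    value0 T p = ⨆ (lam : ℝ) (_ : 0 < lam), penalizedValue K T p lam := by
  refine le_antisymm ?_ (iSup₂_le fun lam _ => penalizedValue_le_value0 hK hM hT lam)
  have hε : ∀ n : ℕ, (0 : ℝ) < 1 / ((n : ℝ) + 1) := fun n => Nat.one_div_pos_of_nat
  have hε0 := tendsto_one_div_add_atTop_nhds_zero_nat (𝕜 := ℝ)
  have hlam : Tendsto (fun n : ℕ => (n : ℝ) + 1) atTop atTop :=
    tendsto_atTop_add_const_right _ _ tendsto_natCast_atTop_atTop
  have hex : ∀ n : ℕ, ∃ u, IsVelocity T p u ∧ objective K T p ((n : ℝ) + 1) u <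
      penalizedValue K T p ((n : ℝ) + 1) + ENNReal.ofReal (1 / ((n : ℝ) + 1)) := by
    intro n
    have h : penalizedValue K T p ((n : ℝ) + 1) <
        penalizedValue K T p ((n : ℝ) + 1) + ENNReal.ofReal (1 / ((n : ℝ) + 1)) :=
      ENNReal.lt_add_right ((penalizedValue_le_value0 hK hM hT _).trans_lt hV).ne
        (by simpa using hε n)
    obtain ⟨u, hu⟩ := iInf_lt_iff.1 h
    obtain ⟨hu1, hu2⟩ := iInf_lt_iff.1 hu
    exact ⟨u, hu1, hu2⟩
  choose u hu1 hu2 using hex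
  have h1 := tendsto_objective_value0 hK hM hT hp hV hu1 hε hε0 hlam fun n => (hu2 n).le.trans
    (by gcongr; exact penalizedValue_le_value0 hK hM hT _)
  set S := ⨆ (lam : ℝ) (_ : 0 < lam), penalizedValue K T p lam
  have h2 : Tendsto (fun n : ℕ => S + ENNReal.ofReal (1 / ((n : ℝ) + 1))) atTop (𝓝 S) := by
    have := (ENNReal.tendsto_ofReal hε0).const_add S
    rwa [ENNReal.ofReal_zero, add_zero] at this
  refine le_of_tendsto_of_tendsto' h1 h2 fun n => (hu2 n).le.trans ?_
  gcongr
  exact le_iSup₂ (f := fun (lam : ℝ) (_ : 0 < lam) => penalizedValue K T p lam)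
    ((n : ℝ) + 1) (by positivity)

end Minimizers

end AllTimeOT

end

theorem mainTheorem1 {d : ℕ} {T : ℝ} (hT : 0 < T)
    (K : AllTimeOT.SpaceTime d → ℝ) (p : AllTimeOT.SpaceTime d → ℝ)
    (hA1 : AllTimeOT.KernelAdmissible K) (hA2 : AllTimeOT.KernelMoment K)
    (hA3 : AllTimeOT.FlowAdmissible T p) (hV : AllTimeOT.value0 T p < ⊤) :
    (∀ (ε lam : ℕ → ℝ) (u : ℕ → AllTimeOT.SpaceTime d → AllTimeOT.Space d),
      (∀ n, 0 < ε n) → Tendsto ε atTop (𝓝 0) →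
      (∀ n, 0 < lam n) → Tendsto lam atTop atTop →
      (∀ n, AllTimeOT.IsVelocity T p (u n)) →
      (∀ n, AllTimeOT.objective K T p (lam n) (u n) ≤
        AllTimeOT.penalizedValue K T p (lam n) + ENNReal.ofReal (ε n)) →
      Tendsto (fun n => ENNReal.ofReal (lam n) * AllTimeOT.penalty K T p (u n)) atTop (𝓝 0) ∧
      Tendsto (fun n => AllTimeOT.objective K T p (lam n) (u n)) atTop
        (𝓝 (AllTimeOT.value0 T p)) ∧
      ∀ ustar : AllTimeOT.SpaceTime d → AllTimeOT.Space d,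
        AllTimeOT.IsUniqueGradientMinimizer T p ustar →
        (∀ n, MemLp (u n) 2 (AllTimeOT.flowMeasure T p)) ∧
        MemLp ustar 2 (AllTimeOT.flowMeasure T p) ∧
        Tendsto (fun n => eLpNorm (u n - ustar) 2 (AllTimeOT.flowMeasure T p)) atTop (𝓝 0)) ∧
    AllTimeOT.value0 T p = ⨆ (lam : ℝ) (_ : 0 < lam), AllTimeOT.penalizedValue K T p lam := by
  refine ⟨?_, AllTimeOT.value0_eq_iSup_penalizedValue hA1 hA2 hT hA3 hV⟩
  intro ε lam u hε hε0 _ hlam hu hobj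
  have hobj' : ∀ n, AllTimeOT.objective K T p (lam n) (u n) ≤
      AllTimeOT.value0 T p + ENNReal.ofReal (ε n) := fun n =>
    (hobj n).trans (by gcongr; exact AllTimeOT.penalizedValue_le_value0 hA1 hA2 hT _)
  have hkin := AllTimeOT.tendsto_kineticEnergy_value0 hA1 hA2 hT hA3 hV hu hε hε0 hlam hobj'
  have hlimobj := AllTimeOT.tendsto_objective_value0 hA1 hA2 hT hA3 hV hu hε hε0 hlam hobj'
  have hfinite : ∀ n, AllTimeOT.kineticEnergy T p (u n) ≠ ⊤ := fun n =>
    ne_top_of_le_ne_top (ENNReal.add_ne_top.2 ⟨hV.ne, ENNReal.ofReal_ne_top⟩)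
      (le_self_add.trans (hobj' n))
  refine ⟨?_, hlimobj, fun ustar hstar => ⟨fun n => ?_, ?_, ?_⟩⟩
  · have h := ENNReal.Tendsto.sub hlimobj hkin (Or.inl hV.ne)
    rw [tsub_self] at h
    refine h.congr fun n => ?_
    rw [AllTimeOT.objective, ENNReal.add_sub_cancel_left (hfinite n)]
  · exact AllTimeOT.memLp_two_of_kineticEnergy_ne_top (hu n).integrable.1 (hfinite n)
  · refine AllTimeOT.memLp_two_of_kineticEnergy_ne_top hstar.isAdmissible.isVelocity.integrable.1 ?_
    rw [hstar.isMinimizer]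
    exact hV.ne
  · refine tendsto_of_subseq_tendsto fun ns hns => ?_
    obtain ⟨ms, w, hw, hwmin, hlim, -⟩ := AllTimeOT.exists_subseq_tendsto_minimizer hA1 hA2 hT hA3
      hV (fun n => hu (ns n)) (fun n => hε (ns n)) (hε0.comp hns) (hlam.comp hns)
      fun n => hobj' (ns n)
    refine ⟨ms, hlim.congr fun n => eLpNorm_congr_ae ?_⟩
    filter_upwards [hstar.unique w hw hwmin] with z hz
    rw [Pi.sub_apply, Pi.sub_apply, hz]
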